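/- Let $d\in\mathbb N$, $\alpha\in(-\tfrac12,\infty)^d$ and $0<\lambda<\beta<1$. On $\mathbb R_+^d=(0,\infty)^d$ let $\mu_\alpha$ be the Laguerre probability measure $$d\mu_\alpha(x)=\prod_{i=1}^d\frac{x_i^{\alpha_i}e^{-x_i}}{\Gamma(\alpha_i+1)}\,dx,$$ and let $L_k^\alpha(x)=\prod_{i=1}^d L_{k_i}^{\alpha_i}(x_i)$, $k\in\mathbb N^d$, $\mathbb N=\{0,1,2,\dots\}$, be the Laguerre polynomials, where $L_m^{a}(s)=\frac1{m!}e^{s}s^{-a}\frac{d^m}{ds^m}(e^{-s}s^{m+a})$. They form an orthogonal basis of $L^2(\mu_\alpha)$ and are the eigenfunctions, with eigenvalues $|k|=k_1+\dots+k_d$, of the Laguerre operator $\mathcal L_\alpha=-\sum_{i=1}^d\big[x_i\partial_i^2+(\alpha_i+1-x_i)\partial_i\big]$. For $t>0$ let $T_t^\alpha f(x)=\int_{\mathbb R_+^d} G_t^\alpha(x,y)f(y)\,d\mu_\alpha(y)$ be the Laguerre semigroup $e^{-t\mathcal L_\alpha}$, with kernel $$G_t^\alpha(x,y)=\prod_{j=1}^d\frac{\Gamma(\alpha_j+1)}{1-e^{-t}}\,e^{-\frac{e^{-t}}{1-e^{-t}}(x_j+y_j)}\big(\sqrt{e^{-t}x_jy_j}\big)^{-\alpha_j}I_{\alpha_j}\!\Big(\frac{2\sqrt{e^{-t}x_jy_j}}{1-e^{-t}}\Big),$$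 $I_\nu$ being the modified Bessel function of the first kind, and let $P_t^\alpha f(x)=\frac1{\sqrt\pi}\int_0^\infty\frac{e^{-u}}{\sqrt u}\,T^\alpha_{t^2/(4u)}f(x)\,du$ be the Poisson–Laguerre semigroup $e^{-t\sqrt{\mathcal L_\alpha}}$. For $\gamma>0$ let $n$ be the smallest integer greater than $\gamma$. The space $Lip_\gamma(\mu_\alpha)$ consists of the real-valued $f\in L^\infty(\mu_\alpha)$ for which there is $A\ge0$ with $$\Big\|\frac{\partial^nP_t^\alpha f}{\partial t^n}\Big\|_\infty\le A\,t^{-n+\gamma}\qquad\text{for all }t>0;$$ $A_\gamma(f)$ denotes the smallest such $A$, and $\|f\|_{Lip_\gamma(\mu_\alpha)}=\|f\|_\infty+A_\gamma(f)$. Then there is a constant $C$, depending only on $d,\alpha,\beta,\lambda$, such that for every $f\in Lip_\beta(\mu_\alpha)$: (a) the integral $$\mathcal D_\lambda^\alpha f(x)=\frac1{c_\lambda}\int_0^\infty t^{-\lambda-1}\big(e^{-t}P_t^\alpha f(x)-f(x)\big)\,dt,\qquad c_\lambda=\int_0^\infty u^{-\lambda-1}(e^{-u}-1)\,du,$$ converges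 absolutely for $\mu_\alpha$-almost every $x$; (b) $\mathcal D_\lambda^\alpha f=(I+\sqrt{\mathcal L_\alpha})^\lambda f$, that is, $f,\mathcal D_\lambda^\alpha f\in L^2(\mu_\alpha)$ and $\int \mathcal D_\lambda^\alpha f\,L_k^\alpha\,d\mu_\alpha=(1+\sqrt{|k|})^\lambda\int f\,L_k^\alpha\,d\mu_\alpha$ for all $k\in\mathbb N^d$; (c) $\mathcal D_\lambda^\alpha f\in Lip_{\beta-\lambda}(\mu_\alpha)$ and $\|\mathcal D_\lambda^\alpha f\|_{Lip_{\beta-\lambda}(\mu_\alpha)}\le C\,\|f\|_{Lip_\beta(\mu_\alpha)}$. In other words, the Bessel–Laguerre fractional derivative $(I+\sqrt{\mathcal L_\alpha})^\lambda$ is bounded from $Lip_\beta(\mu_\alpha)$ to $Lip_{\beta-\lambda}(\mu_\alpha)$ and is given there by the integral formula. -/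

import Mathlib

open MeasureTheory Set

noncomputable section

namespace LaguerreLip

/-- The Laguerre probability measure of type `α`, carried by the open orthant `(0,∞)^d`:
`dμ_α(x) = ∏ i, x_i ^ α_i * e ^ (-x_i) / Γ(α_i + 1) dx`. -/
def laguerreMeasure {d : ℕ} (α : Fin d → ℝ) : Measure (Fin d → ℝ) :=
  (volume.restrict (Set.univ.pi fun _ : Fin d => Ioi (0 : ℝ))).withDensity fun x =>
    ENNReal.ofReal (∏ i, x i ^ α i * Real.exp (-x i) / Real.Gamma (α i + 1))

/-- The one-dimensional Laguerre polynomial of degree `k` and type `a`, by Rodrigues' formula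
(a polynomial in `x` on `x > 0`, the only place where it is used). -/
def laguerre1 (a : ℝ) (k : ℕ) (x : ℝ) : ℝ :=
  1 / (k.factorial : ℝ) * Real.exp x * x ^ (-a) *
    iteratedDeriv k (fun u : ℝ => Real.exp (-u) * u ^ ((k : ℝ) + a)) x

/-- The `d`-dimensional Laguerre polynomials: tensor products of the one-dimensional ones. They are
the eigenfunctions of the Laguerre operator
`L_α = -∑ i, (x_i ∂_i² + (α_i + 1 - x_i) ∂_i)`, with eigenvalue `|k| = ∑ i, k i`. -/
def laguerre {d : ℕ} (α : Fin d → ℝ) (k : Fin d → ℕ) (x : Fin d → ℝ) : ℝ :=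
  ∏ i, laguerre1 (α i) (k i) (x i)

/-- The modified Bessel function of the first kind `I_ν(z)`, for `z > 0`. -/
def besselI (ν z : ℝ) : ℝ :=
  ∑' m : ℕ, (z / 2) ^ (2 * (m : ℝ) + ν) / ((m.factorial : ℝ) * Real.Gamma ((m : ℝ) + ν + 1))

/-- The Laguerre heat kernel `G_t^α(x, y)` with respect to `μ_α`, for `t > 0`. -/
def heatKernel {d : ℕ} (α : Fin d → ℝ) (t : ℝ) (x y : Fin d → ℝ) : ℝ :=
  ∏ j, Real.Gamma (α j + 1) / (1 - Real.exp (-t)) *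
    Real.exp (-(Real.exp (-t) / (1 - Real.exp (-t)) * (x j + y j))) *
    Real.sqrt (Real.exp (-t) * x j * y j) ^ (-α j) *
    besselI (α j) (2 * Real.sqrt (Real.exp (-t) * x j * y j) / (1 - Real.exp (-t)))

/-- The Laguerre semigroup `T_t^α = e^{-t L_α}`, for `t > 0`. -/
def heatSemigroup {d : ℕ} (α : Fin d → ℝ) (t : ℝ) (f : (Fin d → ℝ) → ℝ) (x : Fin d → ℝ) : ℝ :=
  ∫ y, heatKernel α t x y * f y ∂(laguerreMeasure α)

/-- The Poisson-Laguerre semigroup `P_t^α = e^{-t √L_α}`, for `t > 0`, by subordination. -/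
def poissonSemigroup {d : ℕ} (α : Fin d → ℝ) (t : ℝ) (f : (Fin d → ℝ) → ℝ)
    (x : Fin d → ℝ) : ℝ :=
  1 / Real.sqrt Real.pi * ∫ u in Ioi (0 : ℝ),
    Real.exp (-u) / Real.sqrt u * heatSemigroup α (t ^ 2 / (4 * u)) f x

/-- `A ≥ 0` is a Lipschitz constant of order `β` for `f`: with `n` the smallest integer greater
than `β`, `‖∂ⁿ P_t f / ∂tⁿ‖_∞ ≤ A t^(-n+β)` for all `t > 0`. -/
def IsLipConst {d : ℕ} (α : Fin d → ℝ) (β : ℝ) (f : (Fin d → ℝ) → ℝ) (A : ℝ) : Prop :=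
  0 ≤ A ∧ ∀ t : ℝ, 0 < t →
    eLpNorm (fun x => iteratedDeriv (⌊β⌋₊ + 1) (fun s : ℝ => poissonSemigroup α s f x) t)
        ⊤ (laguerreMeasure α)
      ≤ ENNReal.ofReal (A * t ^ (-((⌊β⌋₊ + 1 : ℕ) : ℝ) + β))

/-- Membership in the Laguerre Lipschitz space `Lip_β(μ_α)`. -/
def MemLip {d : ℕ} (α : Fin d → ℝ) (β : ℝ) (f : (Fin d → ℝ) → ℝ) : Prop :=
  MemLp f ⊤ (laguerreMeasure α) ∧ ∃ A : ℝ, IsLipConst α β f A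

/-- The norm of `Lip_β(μ_α)`: `‖f‖_∞ + A_β(f)`, with `A_β(f)` the smallest Lipschitz constant. -/
def lipNorm {d : ℕ} (α : Fin d → ℝ) (β : ℝ) (f : (Fin d → ℝ) → ℝ) : ℝ :=
  (eLpNorm f ⊤ (laguerreMeasure α)).toReal + sInf {A : ℝ | IsLipConst α β f A}

/-- `c_λ = ∫_0^∞ u^(-λ-1) (e^(-u) - 1) du`. -/
def cConst (lam : ℝ) : ℝ :=
  ∫ u in Ioi (0 : ℝ), u ^ (-lam - 1) * (Real.exp (-u) - 1)

/-- The integrand of the integral representation of the Bessel-Laguerre fractional derivative: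
`t^(-λ-1) (e^(-t) P_t^α f(x) - f(x))`. -/
def besselDerivIntegrand {d : ℕ} (α : Fin d → ℝ) (lam : ℝ) (f : (Fin d → ℝ) → ℝ)
    (x : Fin d → ℝ) (t : ℝ) : ℝ :=
  t ^ (-lam - 1) * (Real.exp (-t) * poissonSemigroup α t f x - f x)

/-- The Bessel-Laguerre fractional derivative of order `λ ∈ (0,1)`, in its integral form. -/
def besselDeriv {d : ℕ} (α : Fin d → ℝ) (lam : ℝ) (f : (Fin d → ℝ) → ℝ) (x : Fin d → ℝ) : ℝ :=
  1 / cConst lam * ∫ t in Ioi (0 : ℝ), besselDerivIntegrand α lam f x t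

/-- `g = (I + √L_α)^λ f` in the spectral sense in `L²(μ_α)`, where the orthogonal basis of Laguerre
polynomials diagonalizes the operator: the Laguerre coefficient of `g` of index `k` is
`(1 + √|k|)^λ` times that of `f`. -/
def IsSpectralBesselDeriv {d : ℕ} (α : Fin d → ℝ) (lam : ℝ) (f g : (Fin d → ℝ) → ℝ) : Prop :=
  MemLp f 2 (laguerreMeasure α) ∧ MemLp g 2 (laguerreMeasure α) ∧
    ∀ k : Fin d → ℕ,
      ∫ x, g x * laguerre α k x ∂(laguerreMeasure α) =
        (1 + Real.sqrt ((∑ i, k i : ℕ) : ℝ)) ^ lam *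
          ∫ x, f x * laguerre α k x ∂(laguerreMeasure α)

end LaguerreLip

end

/-!
The theorem is proved on the side of the Laguerre coefficients `∫ f L_k dμ_α`, with uniform bounds
taken from the kernels.

*The heat kernel.* Expanding the Bessel function shows that `G_t(x, ·) μ_α` is, in each variable, a
Poisson mixture of Gamma laws. Its moments follow from the Chu–Vandermonde identity, and they say
that on the normalized monomials `y ^ j / Γ(a + j + 1)` the heat semigroup acts as the substitution
`X ↦ (1 - q) + q X`, `q = e ^ (-t)`, acts on `X ^ j` (`heatKernel1_moment`). Under the same
correspondence `L_k^a` is a multiple of `(1 - X) ^ k`, which the substitution multiplies by `q ^ k`.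
So the heat semigroup is Markov and has the Laguerre polynomials as eigenfunctions
(`integral_heatKernel_mul_laguerre`).

*The Poisson semigroup.* After a change of variables, `P_t f(x)` is `t` times a Laplace transform
at `t²` of a bounded function, so it is differentiable in `t` with `|∂_t P_t f| ≤ 2 ‖f‖_∞ / t`
(`abs_poissonDeriv_le`). The subordination formula gives its Laguerre coefficients, those of `f`
multiplied by `e ^ (-t √|k|)` (`coeff_poissonSemigroup`).

*Completeness.* A bounded function all of whose Laguerre coefficients vanish is zero
(`ae_eq_zero_of_coeff_eq_zero`): it is orthogonal to polynomials, hence to the exponentials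
`e ^ (-n · x)`, which are reached by finitely many power series expansions of slowly decaying
exponential factors, and these generate an algebra that determines finite measures. Every identity
between bounded functions that is needed afterwards is an identity between coefficients: the
semigroup law, the convergence `P_t f → f` with the rate `t ^ β` for `f ∈ Lip_β`, the spectral
formula for the fractional derivative `g`, and the formula that expresses `∂_t P_t g` as the average
of `e ^ (-s) ∂P_{t+s} f - ∂P_t f` with the weight `s ^ (-λ-1) / c_λ`.

*The estimate.* For `t ≤ 1` this last average is split at `s = t`. Since
`∂P_{t+s} f = P_{s+t/2} ∂P_{t/2} f`, the function `∂P_t f` is Lipschitz in time with a constant of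
order `t ^ (β - 2)`, which controls `s ≤ t`; its size `t ^ (β - 1)` controls `s > t`; both
contributions are of order `t ^ (β - λ - 1)`. For `t ≥ 1` the bound `2 ‖g‖_∞ / t` suffices, `g`
being bounded by a similar splitting of its defining integral.
-/

noncomputable section

namespace LaguerreLip

/-! ### The one-dimensional Laguerre measure -/

/-- The one-dimensional Laguerre probability measure of type `a`. -/
def gammaLaw (a : ℝ) : Measure ℝ :=
  (volume.restrict (Ioi (0 : ℝ))).withDensity fun y =>
    ENNReal.ofReal (y ^ a * Real.exp (-y) / Real.Gamma (a + 1))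

lemma gammaLaw_density_nonneg {a y : ℝ} (ha : -1 < a) (hy : 0 < y) :
    0 ≤ y ^ a * Real.exp (-y) / Real.Gamma (a + 1) := by
  have := Real.Gamma_pos_of_pos (show 0 < a + 1 by linarith)
  positivity

lemma measurable_gammaLaw_density (a : ℝ) :
    Measurable fun y : ℝ => y ^ a * Real.exp (-y) / Real.Gamma (a + 1) := by
  fun_prop

lemma ae_gammaLaw (a : ℝ) : ∀ᵐ y ∂gammaLaw a, 0 < y :=
  (withDensity_absolutelyContinuous _ _).ae_le (ae_restrict_mem measurableSet_Ioi)

lemma integral_gammaLaw {a : ℝ} (ha : -1 < a) (h : ℝ → ℝ) :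
    ∫ y, h y ∂gammaLaw a =
      ∫ y in Ioi (0 : ℝ), y ^ a * Real.exp (-y) / Real.Gamma (a + 1) * h y := by
  rw [gammaLaw, integral_withDensity_eq_integral_toReal_smul
    (measurable_gammaLaw_density a).ennreal_ofReal (by simp)]
  refine setIntegral_congr_fun measurableSet_Ioi fun y hy => ?_
  simp [ENNReal.toReal_ofReal (gammaLaw_density_nonneg ha hy)]

lemma integrable_gammaLaw {a : ℝ} (ha : -1 < a) (h : ℝ → ℝ) :
    Integrable h (gammaLaw a) ↔
      IntegrableOn (fun y => y ^ a * Real.exp (-y) / Real.Gamma (a + 1) * h y) (Ioi (0 : ℝ)) := by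
  rw [gammaLaw, integrable_withDensity_iff_integrable_smul'
    (measurable_gammaLaw_density a).ennreal_ofReal (by simp)]
  refine integrableOn_congr_fun (fun y hy => ?_) measurableSet_Ioi
  simp [ENNReal.toReal_ofReal (gammaLaw_density_nonneg ha hy)]

lemma gammaLaw_moment_density {a θ : ℝ} (n : ℕ) {y : ℝ} (hy : y ∈ Ioi (0 : ℝ)) :
    y ^ a * Real.exp (-y) / Real.Gamma (a + 1) * (y ^ n * Real.exp (θ * y)) =
      1 / Real.Gamma (a + 1) * (y ^ ((a + n + 1) - 1) * Real.exp (-((1 - θ) * y))) := by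
  have h1 : y ^ ((a + n + 1) - 1) = y ^ a * y ^ n := by
    rw [show (a + n + 1) - 1 = a + n by ring, Real.rpow_add hy, Real.rpow_natCast]
  have h2 : Real.exp (-((1 - θ) * y)) = Real.exp (-y) * Real.exp (θ * y) := by
    rw [← Real.exp_add]; ring_nf
  rw [h1, h2]; ring

lemma integral_gammaLaw_pow_mul_exp {a θ : ℝ} (ha : -1 < a) (hθ : θ < 1) (n : ℕ) :
    ∫ y, y ^ n * Real.exp (θ * y) ∂gammaLaw a =
      Real.Gamma (a + n + 1) / Real.Gamma (a + 1) * (1 / (1 - θ)) ^ (a + n + 1) := by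
  have hn : (0 : ℝ) ≤ n := n.cast_nonneg
  rw [integral_gammaLaw ha, setIntegral_congr_fun measurableSet_Ioi
    (fun y hy => gammaLaw_moment_density n hy), integral_const_mul,
    Real.integral_rpow_mul_exp_neg_mul_Ioi (by linarith) (by linarith)]
  ring

lemma integrable_gammaLaw_pow_mul_exp {a θ : ℝ} (ha : -1 < a) (hθ : θ < 1) (n : ℕ) :
    Integrable (fun y => y ^ n * Real.exp (θ * y)) (gammaLaw a) := by
  have hn : (0 : ℝ) ≤ n := n.cast_nonneg
  rw [integrable_gammaLaw ha, integrableOn_congr_fun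
    (fun y hy => gammaLaw_moment_density n hy) measurableSet_Ioi]
  refine Integrable.const_mul ?_ _
  have := integrableOn_rpow_mul_exp_neg_mul_rpow (p := 1) (s := a + n + 1 - 1) (b := 1 - θ)
    (by linarith) one_pos (by linarith)
  simp only [Real.rpow_one, neg_mul] at this
  exact this

instance (a : ℝ) : SFinite (gammaLaw a) := by unfold gammaLaw; infer_instance

lemma isProbabilityMeasure_gammaLaw {a : ℝ} (ha : -1 < a) : IsProbabilityMeasure (gammaLaw a) := by
  have hG := Real.Gamma_pos_of_pos (show 0 < a + 1 by linarith)
  have hi := integrable_gammaLaw_pow_mul_exp ha zero_lt_one 0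
  have he := integral_gammaLaw_pow_mul_exp ha zero_lt_one 0
  simp only [pow_zero, zero_mul, Real.exp_zero, mul_one, CharP.cast_eq_zero, add_zero, sub_zero,
    div_one, Real.one_rpow, div_self hG.ne'] at hi he
  have : IsFiniteMeasure (gammaLaw a) := by
    rw [integrable_const_iff] at hi; simpa using hi
  simp only [integral_const, smul_eq_mul, mul_one] at he
  exact ⟨by rwa [measureReal_def, ENNReal.toReal_eq_one_iff] at he⟩

/-- The Laguerre measure is the product of the one-dimensional ones. -/
lemma laguerreMeasure_eq_pi {d : ℕ} {α : Fin d → ℝ} (hα : ∀ i, -1 < α i) :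
    laguerreMeasure α = Measure.pi fun i => gammaLaw (α i) := by
  have := fun i => isProbabilityMeasure_gammaLaw (hα i)
  symm
  refine Measure.pi_eq fun s hs => ?_
  have hm : Measurable fun x : Fin d → ℝ =>
      ∏ i, x i ^ α i * Real.exp (-x i) / Real.Gamma (α i + 1) := by fun_prop
  have hi : ∀ i, Integrable ((s i).indicator fun y : ℝ =>
      y ^ α i * Real.exp (-y) / Real.Gamma (α i + 1)) (volume.restrict (Ioi 0)) := fun i => by
    refine Integrable.indicator ?_ (hs i)
    simpa [IntegrableOn] using (integrable_gammaLaw (hα i) (fun _ => 1)).1 (integrable_const 1)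
  have hn : ∀ i, 0 ≤ᵐ[volume.restrict (Ioi 0)] ((s i).indicator fun y : ℝ =>
      y ^ α i * Real.exp (-y) / Real.Gamma (α i + 1)) := fun i => by
    filter_upwards [ae_restrict_mem measurableSet_Ioi] with y hy
    exact indicator_apply_nonneg fun _ => gammaLaw_density_nonneg (hα i) hy
  have e1 : ∀ i, gammaLaw (α i) (s i) = ENNReal.ofReal (∫ y in Ioi (0 : ℝ),
      (s i).indicator (fun y : ℝ => y ^ α i * Real.exp (-y) / Real.Gamma (α i + 1)) y) := fun i => by
    rw [gammaLaw, withDensity_apply _ (hs i), ofReal_integral_eq_lintegral_ofReal (hi i) (hn i),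
      ← lintegral_indicator (hs i)]
    congr 1 with y
    by_cases h : y ∈ s i <;> simp [h]
  rw [Finset.prod_congr rfl fun i _ => e1 i, ← ENNReal.ofReal_prod_of_nonneg
    fun i _ => integral_nonneg_of_ae (hn i), ← integral_fintype_prod_eq_prod
    (fun i => (s i).indicator (fun y : ℝ => y ^ α i * Real.exp (-y) / Real.Gamma (α i + 1))),
    laguerreMeasure, volume_pi, Measure.restrict_pi_pi,
    withDensity_apply _ (MeasurableSet.univ_pi hs), ofReal_integral_eq_lintegral_ofReal
    (Integrable.fintype_prod hi), ← lintegral_indicator (MeasurableSet.univ_pi hs)]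
  · congr 1 with x
    by_cases h : x ∈ univ.pi s
    · simp only [h, indicator_of_mem]
      congr 1
      exact Finset.prod_congr rfl fun i _ => by rw [indicator_of_mem (h i (mem_univ i))]
    · simp only [h, not_false_eq_true, indicator_of_notMem]
      obtain ⟨i, hi⟩ : ∃ i, x i ∉ s i := by simpa [mem_univ_pi] using h
      rw [Finset.prod_eq_zero (Finset.mem_univ i) (by rw [indicator_of_notMem hi]),
        ENNReal.ofReal_zero]
  · rw [← Measure.restrict_pi_pi]
    filter_upwards [ae_restrict_mem (MeasurableSet.univ_pi fun _ => measurableSet_Ioi)] with x hx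
    exact Finset.prod_nonneg fun i _ =>
      indicator_apply_nonneg fun _ => gammaLaw_density_nonneg (hα i) (hx i (mem_univ i))

lemma isProbabilityMeasure_laguerreMeasure {d : ℕ} {α : Fin d → ℝ} (hα : ∀ i, -1 < α i) :
    IsProbabilityMeasure (laguerreMeasure α) := by
  have := fun i => isProbabilityMeasure_gammaLaw (hα i)
  rw [laguerreMeasure_eq_pi hα]; infer_instance

lemma ae_laguerreMeasure {d : ℕ} (α : Fin d → ℝ) : ∀ᵐ x ∂laguerreMeasure α, ∀ i, 0 < x i := by
  refine (withDensity_absolutelyContinuous _ _).ae_le ?_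
  filter_upwards [ae_restrict_mem (MeasurableSet.univ_pi fun _ => measurableSet_Ioi)] with x hx i
  exact hx i (mem_univ i)

/-! ### Moments of the heat kernel -/

/-- The one-dimensional Laguerre heat kernel. -/
def heatKernel1 (a t x y : ℝ) : ℝ :=
  Real.Gamma (a + 1) / (1 - Real.exp (-t)) *
    Real.exp (-(Real.exp (-t) / (1 - Real.exp (-t)) * (x + y))) *
    Real.sqrt (Real.exp (-t) * x * y) ^ (-a) *
    besselI a (2 * Real.sqrt (Real.exp (-t) * x * y) / (1 - Real.exp (-t)))

lemma heatKernel_eq_prod {d : ℕ} (α : Fin d → ℝ) (t : ℝ) (x y : Fin d → ℝ) :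
    heatKernel α t x y = ∏ j, heatKernel1 (α j) t (x j) (y j) := rfl

lemma heatKernel_symm {d : ℕ} (α : Fin d → ℝ) (t : ℝ) (x y : Fin d → ℝ) :
    heatKernel α t x y = heatKernel α t y x := by
  unfold heatKernel
  refine Finset.prod_congr rfl fun j _ => ?_
  rw [add_comm (x j), mul_right_comm _ (x j)]

/-- The terms of the series expansion of the one-dimensional heat kernel. -/
def heatTerm (a q x : ℝ) (m : ℕ) (y : ℝ) : ℝ :=
  Real.Gamma (a + 1) * Real.exp (-(q / (1 - q) * x)) * (q * x) ^ m /
    ((1 - q) ^ (2 * (m : ℝ) + a + 1) * m.factorial * Real.Gamma (m + a + 1)) *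
    (y ^ m * Real.exp (-(q / (1 - q)) * y))

lemma heatKernel1_eq_tsum {a t x y : ℝ} (ht : 0 < t) (hx : 0 < x) (hy : 0 < y) :
    heatKernel1 a t x y = ∑' m, heatTerm a (Real.exp (-t)) x m y := by
  have hq : 0 < 1 - Real.exp (-t) := by simpa using ht
  have hq0 := Real.exp_pos (-t)
  unfold heatKernel1 besselI
  rw [← tsum_mul_left]
  refine tsum_congr fun m => ?_
  unfold heatTerm
  set q := Real.exp (-t)
  set z := Real.sqrt (q * x * y) with hz
  have hz0 : 0 < z := Real.sqrt_pos.2 (by positivity)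
  have hzz : z ^ 2 = q * x * y := Real.sq_sqrt (by positivity)
  have e1 : (2 * z / (1 - q) / 2) ^ (2 * (m : ℝ) + a) =
      z ^ a * (q * x * y) ^ m / (1 - q) ^ (2 * (m : ℝ) + a) := by
    rw [show 2 * z / (1 - q) / 2 = z / (1 - q) by ring, Real.div_rpow hz0.le hq.le,
      Real.rpow_add hz0, ← hzz, ← pow_mul, ← Real.rpow_natCast z]
    push_cast; ring
  have e2 : Real.exp (-(q / (1 - q) * (x + y))) =
      Real.exp (-(q / (1 - q) * x)) * Real.exp (-(q / (1 - q)) * y) := by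
    rw [← Real.exp_add]; ring_nf
  have e3 : (1 - q) ^ (2 * (m : ℝ) + a + 1) = (1 - q) ^ (2 * (m : ℝ) + a) * (1 - q) := by
    rw [Real.rpow_add hq, Real.rpow_one]
  have hz1 : z ^ a ≠ 0 := (Real.rpow_pos_of_pos hz0 a).ne'
  have e4 : z ^ (-a) = (z ^ a)⁻¹ := Real.rpow_neg hz0.le a
  rw [e1, e2, e3, e4, mul_pow (q * x)]
  field_simp

/-- Chu–Vandermonde: rising factorials `Γ(m + b + j) / Γ(m + b)` in terms of the falling
factorials of `m`. -/
lemma gamma_vandermonde {b : ℝ} (hb : 0 < b) (m j : ℕ) :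
    Real.Gamma (m + b + j) / Real.Gamma (m + b) =
      ∑ i ∈ Finset.range (j + 1),
        (j.choose i : ℝ) * m.descFactorial i * (Real.Gamma (b + j) / Real.Gamma (b + i)) := by
  have hm : (0 : ℝ) ≤ m := m.cast_nonneg
  induction j with
  | zero =>
    have h1 := (Real.Gamma_pos_of_pos (show 0 < m + b by linarith)).ne'
    have h2 := (Real.Gamma_pos_of_pos hb).ne'
    simp [h1, h2]
  | succ j ih =>
    have hj : (0 : ℝ) ≤ j := j.cast_nonneg
    have hG : Real.Gamma (m + b + (j + 1 : ℕ)) = (m + b + j) * Real.Gamma (m + b + j) := by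
      rw [← Real.Gamma_add_one (by linarith)]; push_cast; ring_nf
    have hG2 : Real.Gamma (b + (j + 1 : ℕ)) = (b + j) * Real.Gamma (b + j) := by
      rw [← Real.Gamma_add_one (by linarith)]; push_cast; ring_nf
    have hd : ∀ i : ℕ, (m.descFactorial (i + 1) : ℝ) = (m - i) * m.descFactorial i := fun i => by
      rw [Nat.descFactorial_succ]
      rcases le_or_gt i m with h | h
      · push_cast [Nat.cast_sub h]; ring
      · rw [Nat.descFactorial_of_lt h]; simp
    set u : ℕ → ℝ := fun i => (j.choose i : ℝ) * m.descFactorial i *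
      (Real.Gamma (b + j) / Real.Gamma (b + i)) with hu
    -- Multiplication by `m + b + j = (m - i) + (b + i + j)` raises the degree; regroup by degree.
    have hstep : ∀ i : ℕ, (m + b + j) * u i =
        (j.choose i : ℝ) * m.descFactorial (i + 1) * (Real.Gamma (b + j) / Real.Gamma (b + i)) +
        (b + i + j) * u i := fun i => by
      rw [hd, hu]; ring
    rw [hG, mul_div_assoc, ih, Finset.mul_sum, Finset.sum_congr rfl fun i _ => hstep i,
      Finset.sum_add_distrib, Finset.sum_range_succ' _ (j + 1)]
    have hlast : ∑ i ∈ Finset.range (j + 1), (b + i + j) * u i =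
        ∑ i ∈ Finset.range (j + 1), (b + (i + 1 : ℕ) + j) * u (i + 1) + (b + (0 : ℕ) + j) * u 0 := by
      rw [← Finset.sum_range_succ' (fun i : ℕ => (b + i + j) * u i), Finset.sum_range_succ _ (j + 1)]
      simp [hu]
    rw [hlast, ← add_assoc, ← Finset.sum_add_distrib]
    congr 1
    · refine Finset.sum_congr rfl fun i _ => ?_
      have hi : (0 : ℝ) ≤ i := i.cast_nonneg
      have hc : (j.choose (i + 1) : ℝ) * (i + 1) = j.choose i * (j - i) := by
        have := Nat.choose_succ_right_eq j i
        rcases le_or_gt i j with h | h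
        · rw [← Nat.cast_sub h]; exact_mod_cast this
        · rw [Nat.choose_eq_zero_of_lt h, Nat.choose_eq_zero_of_lt (by omega)]; simp
      have hG3 : Real.Gamma (b + (i + 1 : ℕ)) = (b + i) * Real.Gamma (b + i) := by
        rw [← Real.Gamma_add_one (by linarith)]; push_cast; ring_nf
      have h1 := (Real.Gamma_pos_of_pos (show 0 < b + i by linarith)).ne'
      have h2 : b + i ≠ 0 := by positivity
      rw [Nat.choose_succ_succ, hG2, hu]
      simp only [hG3]
      field_simp
      push_cast
      linear_combination (m.descFactorial (i + 1) : ℝ) * hc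
    · rw [hG2]; simp [hu]; ring

lemma HasSum.of_eq {f g : ℕ → ℝ} {s t : ℝ} (h : HasSum f s) (hfg : ∀ m, g m = f m)
    (hst : t = s) : HasSum g t := by
  rw [hst, funext hfg]; exact h

/-- The factorial-type moments of the Poisson law of mean `c`. -/
lemma hasSum_poisson_gamma {b : ℝ} (hb : 0 < b) (c : ℝ) (j : ℕ) :
    HasSum (fun m : ℕ => c ^ m / m.factorial * (Real.Gamma (m + b + j) / Real.Gamma (m + b)))
      (Real.exp c * ∑ i ∈ Finset.range (j + 1),
        (j.choose i : ℝ) * c ^ i * (Real.Gamma (b + j) / Real.Gamma (b + i))) := by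
  have hfall : ∀ i : ℕ, HasSum (fun m : ℕ => c ^ m / m.factorial * (m.descFactorial i : ℝ))
      (Real.exp c * c ^ i) := fun i => by
    have h0 : HasSum (fun m : ℕ => c ^ m / m.factorial * c ^ i) (Real.exp c * c ^ i) := by
      have := NormedSpace.expSeries_div_hasSum_exp (𝔸 := ℝ) c
      rw [← Real.exp_eq_exp_ℝ] at this
      exact this.mul_right _
    rw [← hasSum_nat_add_iff' i, Finset.sum_eq_zero, sub_zero]
    · refine h0.congr_fun fun m => ?_
      have : ((m.factorial : ℕ) : ℝ) * ((m + i).descFactorial i : ℕ) = (m + i).factorial := by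
        have := Nat.factorial_mul_descFactorial (Nat.le_add_left i m)
        rw [Nat.add_sub_cancel] at this
        exact_mod_cast this
      have h1 : (m.factorial : ℝ) ≠ 0 := by positivity
      have h2 : ((m + i).factorial : ℝ) ≠ 0 := by positivity
      rw [pow_add]; field_simp; rw [← this]; ring
    · intro m hm
      rw [Nat.descFactorial_of_lt (Finset.mem_range.1 hm)]; simp
  simp_rw [gamma_vandermonde hb, Finset.mul_sum]
  refine hasSum_sum fun i _ => ?_
  refine HasSum.of_eq ((hfall i).mul_left ((j.choose i : ℝ) *
    (Real.Gamma (b + j) / Real.Gamma (b + i)))) (fun m => ?_) ?_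
  · ring
  · ring

/-- The terms of the kernel series have Gamma integrals against the normalized monomials, and these
integrals sum up to moments of the Poisson law of mean `q x / (1 - q)`. -/
lemma hasSum_integral_heatTerm {a q x : ℝ} (ha : -1 < a) (hq0 : 0 < q) (hq1 : q < 1) (hx : 0 < x)
    (j : ℕ) :
    (∀ m, Integrable (fun y => heatTerm a q x m y * (y ^ j / Real.Gamma (a + j + 1)))
      (gammaLaw a)) ∧
    HasSum (fun m => ∫ y, heatTerm a q x m y * (y ^ j / Real.Gamma (a + j + 1)) ∂gammaLaw a)
      (∑ i ∈ Finset.range (j + 1), (j.choose i : ℝ) * q ^ i * (1 - q) ^ (j - i) *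
        (x ^ i / Real.Gamma (a + i + 1))) := by
  have hp : 0 < 1 - q := by linarith
  have hθ : -(q / (1 - q)) < 1 := by
    have : 0 < q / (1 - q) := by positivity
    linarith
  set K : ℕ → ℝ := fun m => Real.Gamma (a + 1) * Real.exp (-(q / (1 - q) * x)) * (q * x) ^ m /
    ((1 - q) ^ (2 * (m : ℝ) + a + 1) * m.factorial * Real.Gamma (m + a + 1)) /
    Real.Gamma (a + j + 1) with hK
  have hterm : ∀ m y, heatTerm a q x m y * (y ^ j / Real.Gamma (a + j + 1)) =
      K m * (y ^ (m + j) * Real.exp (-(q / (1 - q)) * y)) := fun m y => by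
    rw [heatTerm, hK, pow_add]; ring
  simp_rw [hterm]
  refine ⟨fun m => (integrable_gammaLaw_pow_mul_exp ha hθ _).const_mul _, ?_⟩
  have hs := (hasSum_poisson_gamma (show 0 < a + 1 by linarith) (q * x / (1 - q)) j).mul_left
    (Real.exp (-(q / (1 - q) * x)) * (1 - q) ^ j / Real.Gamma (a + j + 1))
  have hj0 : (0 : ℝ) ≤ j := j.cast_nonneg
  have hGj := (Real.Gamma_pos_of_pos (show 0 < a + j + 1 by linarith)).ne'
  refine HasSum.of_eq hs (fun m => ?_) ?_
  · have hm0 : (0 : ℝ) ≤ m := m.cast_nonneg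
    have hGm := (Real.Gamma_pos_of_pos (show 0 < m + a + 1 by linarith)).ne'
    have hG1 := (Real.Gamma_pos_of_pos (show 0 < a + 1 by linarith)).ne'
    have hpa := (Real.rpow_pos_of_pos hp (a + 1)).ne'
    rw [integral_const_mul, integral_gammaLaw_pow_mul_exp ha hθ]
    simp only [hK]
    have e1 : 1 / (1 - -(q / (1 - q))) = 1 - q := by field_simp; ring
    have e2 : (1 - q) ^ (a + (m + j : ℕ) + 1) = (1 - q) ^ (a + 1) * (1 - q) ^ m * (1 - q) ^ j := by
      rw [show a + (m + j : ℕ) + 1 = (a + 1) + m + j by push_cast; ring, Real.rpow_add hp,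
        Real.rpow_add hp, Real.rpow_natCast, Real.rpow_natCast]
    have e3 : (1 - q) ^ (2 * (m : ℝ) + a + 1) = (1 - q) ^ (a + 1) * (1 - q) ^ m * (1 - q) ^ m := by
      rw [show 2 * (m : ℝ) + a + 1 = (a + 1) + m + m by ring, Real.rpow_add hp,
        Real.rpow_add hp, Real.rpow_natCast]
    have e4 : a + ((m + j : ℕ) : ℝ) + 1 = m + (a + 1) + j := by push_cast; ring
    have e5 : (m : ℝ) + a + 1 = m + (a + 1) := by ring
    rw [e1, e2, e3, e4, e5, div_pow]
    rw [e5] at hGm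
    field_simp
  · rw [← mul_assoc, Finset.mul_sum]
    symm
    refine Finset.sum_congr rfl fun i hi => ?_
    have hij : i ≤ j := Nat.lt_succ_iff.1 (Finset.mem_range.1 hi)
    have he : Real.exp (-(q / (1 - q) * x)) * Real.exp (q * x / (1 - q)) = 1 := by
      rw [← Real.exp_add, Real.exp_eq_one_iff]; ring
    have hpow : (1 - q) ^ j = (1 - q) ^ (j - i) * (1 - q) ^ i := by
      rw [← pow_add, Nat.sub_add_cancel hij]
    have e6 : a + 1 + (i : ℝ) = a + i + 1 := by ring
    have e7 : a + 1 + (j : ℝ) = a + j + 1 := by ring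
    rw [e6, e7, hpow, div_pow, mul_pow]
    have hi0 : (0 : ℝ) ≤ i := i.cast_nonneg
    have hGi := (Real.Gamma_pos_of_pos (show 0 < a + i + 1 by linarith)).ne'
    have hpi : (1 - q) ^ i ≠ 0 := by positivity
    generalize Real.exp (-(q / (1 - q) * x)) = E₁ at he ⊢
    generalize Real.exp (q * x / (1 - q)) = E₂ at he ⊢
    field_simp
    linear_combination (j.choose i : ℝ) * he

/-- Termwise integration of a series of nonnegative functions. As the sum of the integrals is not
zero, integrability of the limit follows from its integral not having the default value. -/
lemma integrable_and_integral_of_hasSum {X : Type*} [MeasurableSpace X] {μ : Measure X}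
    {F : ℕ → X → ℝ} {G : X → ℝ} {C : ℝ} (hint : ∀ m, Integrable (F m) μ)
    (hpos : ∀ᵐ y ∂μ, ∀ m, 0 ≤ F m y) (hG : ∀ᵐ y ∂μ, G y = ∑' m, F m y)
    (hsum : HasSum (fun m => ∫ y, F m y ∂μ) C) (hC : C ≠ 0) :
    Integrable G μ ∧ ∫ y, G y ∂μ = C := by
  have hn : ∀ m, ∫ y, ‖F m y‖ ∂μ = ∫ y, F m y ∂μ := fun m => by
    refine integral_congr_ae ?_
    filter_upwards [hpos] with y hy
    rw [Real.norm_of_nonneg (hy m)]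
  have h := hasSum_integral_of_summable_integral_norm hint (by simpa only [hn] using hsum.summable)
  have he : ∫ y, G y ∂μ = C := by
    rw [integral_congr_ae hG]; exact h.unique hsum
  refine ⟨?_, he⟩
  by_contra hni
  exact hC (by rw [← he, integral_undef hni])

lemma heatTerm_nonneg {a q x y : ℝ} (ha : -1 < a) (hq0 : 0 < q) (hq1 : q < 1) (hx : 0 < x)
    (hy : 0 < y) (m : ℕ) : 0 ≤ heatTerm a q x m y := by
  have hm : (0 : ℝ) ≤ m := m.cast_nonneg
  have h1 := Real.Gamma_pos_of_pos (show 0 < m + a + 1 by linarith)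
  have h2 := Real.Gamma_pos_of_pos (show 0 < a + 1 by linarith)
  have h3 : 0 < 1 - q := by linarith
  unfold heatTerm
  positivity

lemma heatKernel1_nonneg {a t x y : ℝ} (ha : -1 < a) (ht : 0 < t) (hx : 0 < x) (hy : 0 < y) :
    0 ≤ heatKernel1 a t x y := by
  rw [heatKernel1_eq_tsum ht hx hy]
  exact tsum_nonneg fun m => heatTerm_nonneg ha (Real.exp_pos _) (by simpa using ht) hx hy m

/-- The heat semigroup acts on the normalized monomials `y ^ j / Γ(a + j + 1)` like the binomial
substitution `X ↦ (1 - q) + q X` acts on `X ^ j`, with `q = e ^ (-t)`. -/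
lemma heatKernel1_moment {a t x : ℝ} (ha : -1 < a) (ht : 0 < t) (hx : 0 < x) (j : ℕ) :
    Integrable (fun y => heatKernel1 a t x y * (y ^ j / Real.Gamma (a + j + 1))) (gammaLaw a) ∧
    ∫ y, heatKernel1 a t x y * (y ^ j / Real.Gamma (a + j + 1)) ∂gammaLaw a =
      ∑ i ∈ Finset.range (j + 1), (j.choose i : ℝ) * Real.exp (-t) ^ i *
        (1 - Real.exp (-t)) ^ (j - i) * (x ^ i / Real.Gamma (a + i + 1)) := by
  have hq1 : Real.exp (-t) < 1 := by simpa using ht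
  have hp : 0 < 1 - Real.exp (-t) := by linarith
  have hq0 := Real.exp_pos (-t)
  obtain ⟨hi, hs⟩ := hasSum_integral_heatTerm ha hq0 hq1 hx j
  have hG : ∀ i : ℕ, 0 < Real.Gamma (a + i + 1) := fun i => by
    have : (0 : ℝ) ≤ i := i.cast_nonneg
    exact Real.Gamma_pos_of_pos (by linarith)
  refine integrable_and_integral_of_hasSum hi ?_ ?_ hs (ne_of_gt ?_)
  · filter_upwards [ae_gammaLaw a] with y hy m
    have := heatTerm_nonneg ha hq0 hq1 hx hy m
    have := hG j
    positivity
  · filter_upwards [ae_gammaLaw a] with y hy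
    rw [tsum_mul_right, heatKernel1_eq_tsum ht hx hy]
  · refine Finset.sum_pos (fun i hi => ?_) ⟨0, by simp⟩
    have h1 := hG i
    have h2 : 0 < (j.choose i : ℝ) := by
      exact_mod_cast Nat.choose_pos (Nat.lt_succ_iff.1 (Finset.mem_range.1 hi))
    positivity

/-! ### Laguerre polynomials -/

open Polynomial in
/-- The umbral evaluation: the linear functional of `ℝ[X]` that sends `X ^ j` to
`y ^ j / Γ(a + j + 1)`. -/
def umbral (a y : ℝ) : ℝ[X] →ₗ[ℝ] ℝ :=
  Polynomial.lsum fun j => (y ^ j / Real.Gamma (a + j + 1)) • LinearMap.id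

open Polynomial in
lemma umbral_X_pow (a y : ℝ) (j : ℕ) : umbral a y (X ^ j) = y ^ j / Real.Gamma (a + j + 1) := by
  simp [umbral, ← Polynomial.monomial_one_right_eq_X_pow, Polynomial.lsum_apply]

open Polynomial in
lemma heatKernel1_umbral {a t x : ℝ} (ha : -1 < a) (ht : 0 < t) (hx : 0 < x) (P : ℝ[X]) :
    Integrable (fun y => heatKernel1 a t x y * umbral a y P) (gammaLaw a) ∧
    ∫ y, heatKernel1 a t x y * umbral a y P ∂gammaLaw a =
      umbral a x (P.comp (C (1 - Real.exp (-t)) + C (Real.exp (-t)) * X)) := by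
  induction P using Polynomial.induction_on' with
  | add p q hp hq =>
    simp only [map_add, mul_add, add_comp]
    exact ⟨hp.1.add hq.1, by rw [integral_add hp.1 hq.1, hp.2, hq.2]⟩
  | monomial j c =>
    obtain ⟨h1, h2⟩ := heatKernel1_moment ha ht hx j
    rw [← smul_X_eq_monomial]
    simp only [map_smul, smul_comp, smul_eq_mul, umbral_X_pow, mul_left_comm _ c]
    refine ⟨h1.const_mul c, ?_⟩
    rw [integral_const_mul, h2, X_pow_comp, add_comm (C _), add_pow, map_sum]
    congr 1
    refine Finset.sum_congr rfl fun i _ => ?_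
    have : (C (Real.exp (-t)) * X) ^ i * C (1 - Real.exp (-t)) ^ (j - i) * (j.choose i : ℝ[X]) =
        (j.choose i * Real.exp (-t) ^ i * (1 - Real.exp (-t)) ^ (j - i)) • X ^ i := by
      rw [mul_pow, smul_eq_C_mul, C_mul, C_mul, C_pow, C_pow, C_eq_natCast]; ring
    rw [this, map_smul, umbral_X_pow, smul_eq_mul]

/-- Falling factorials of a real number as quotients of Gamma values. -/
lemma descPochhammer_eval_eq_gamma {r : ℝ} (n : ℕ) (hr : (n : ℝ) < r + 1) :
    (descPochhammer ℝ n).eval r = Real.Gamma (r + 1) / Real.Gamma (r - n + 1) := by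
  induction n with
  | zero =>
    have := (Real.Gamma_pos_of_pos (show 0 < r + 1 by simpa using hr)).ne'
    simp [this]
  | succ n ih =>
    push_cast at hr
    rw [descPochhammer_succ_eval, ih (by linarith)]
    have h1 := (Real.Gamma_pos_of_pos (show 0 < r - n by linarith)).ne'
    have h2 : r - n ≠ 0 := by intro h; linarith
    rw [Real.Gamma_add_one h2]
    push_cast
    rw [show r - (n + 1) + 1 = r - n by ring]
    field_simp

open Polynomial in
/-- On the half-line, `L_k^a` is a multiple of the umbral image of `(1 - X) ^ k`. -/
lemma laguerre1_eq_umbral {a x : ℝ} (ha : -1 < a) (hx : 0 < x) (k : ℕ) :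
    laguerre1 a k x = Real.Gamma (a + k + 1) / k.factorial * umbral a x ((1 - X) ^ k) := by
  have hexp : ContDiffAt ℝ k (fun u : ℝ => Real.exp (-u)) x := by fun_prop
  have hpow : ContDiffAt ℝ k (fun u : ℝ => u ^ ((k : ℝ) + a)) x :=
    Real.contDiffAt_rpow_const (Or.inl hx.ne')
  have hL := iteratedDeriv_mul hexp hpow
  have e0 : (fun u : ℝ => Real.exp (-u)) * (fun u : ℝ => u ^ ((k : ℝ) + a)) =
      fun u => Real.exp (-u) * u ^ ((k : ℝ) + a) := rfl
  rw [e0] at hL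
  rw [laguerre1, hL, sub_eq_neg_add, add_pow, map_sum, Finset.mul_sum, Finset.mul_sum]
  refine Finset.sum_congr rfl fun i hi => ?_
  have hik : i ≤ k := Nat.lt_succ_iff.1 (Finset.mem_range.1 hi)
  have hi0 : (0 : ℝ) ≤ i := i.cast_nonneg
  have hd1 : iteratedDeriv i (fun u : ℝ => Real.exp (-u)) x = (-1) ^ i * Real.exp (-x) := by
    have := congrFun (iteratedDeriv_exp_const_mul i (-1)) x
    simpa using this
  have hd2 : iteratedDeriv (k - i) (fun u : ℝ => u ^ ((k : ℝ) + a)) x =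
      Real.Gamma (a + k + 1) / Real.Gamma (a + i + 1) * (x ^ a * x ^ i) := by
    rw [iteratedDeriv_eq_iterate, Real.iter_deriv_rpow_const, descPochhammer_eval_eq_gamma,
      Nat.cast_sub hik, show (k : ℝ) + a - (k - i) = a + i by ring, Real.rpow_add hx,
      Real.rpow_natCast, add_comm (k : ℝ)]
    rw [Nat.cast_sub hik]; linarith
  have hu : umbral a x ((-X) ^ i * 1 ^ (k - i) * (k.choose i : ℝ[X])) =
      (-1) ^ i * k.choose i * (x ^ i / Real.Gamma (a + i + 1)) := by
    have : (-X) ^ i * 1 ^ (k - i) * (k.choose i : ℝ[X]) =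
        ((-1) ^ i * (k.choose i : ℝ)) • X ^ i := by
      rw [neg_pow, one_pow, smul_eq_C_mul, C_mul, C_pow, C_neg, C_1, C_eq_natCast]; ring
    rw [this, map_smul, umbral_X_pow, smul_eq_mul]
  have hexp1 : Real.exp x * Real.exp (-x) = 1 := by rw [← Real.exp_add]; simp
  have hx1 : x ^ (-a) * x ^ a = 1 := by rw [← Real.rpow_add hx]; simp
  rw [hd1, hd2, hu]
  have : ∀ A B E₁ E₂ P₁ P₂ c s N y : ℝ, E₁ * E₂ = 1 → P₁ * P₂ = 1 →
      1 / N * E₁ * P₁ * (c * (s * E₂) * (A / B * (P₂ * y))) = A / N * (s * c * (y / B)) := by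
    intro A B E₁ E₂ P₁ P₂ c s N y h1 h2
    calc _ = (E₁ * E₂) * (P₁ * P₂) * (A / N * (s * c * (y / B))) := by ring
      _ = _ := by rw [h1, h2]; ring
  exact this _ _ _ _ _ _ _ _ _ _ hexp1 hx1

open Polynomial in
/-- Laguerre polynomials are eigenfunctions of the one-dimensional heat semigroup: the substitution
`X ↦ (1 - q) + q X` multiplies `1 - X` by `q`. -/
lemma heatKernel1_laguerre1 {a t x : ℝ} (ha : -1 < a) (ht : 0 < t) (hx : 0 < x) (k : ℕ) :
    Integrable (fun y => heatKernel1 a t x y * laguerre1 a k y) (gammaLaw a) ∧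
    ∫ y, heatKernel1 a t x y * laguerre1 a k y ∂gammaLaw a =
      Real.exp (-(t * k)) * laguerre1 a k x := by
  obtain ⟨h1, h2⟩ := heatKernel1_umbral ha ht hx ((1 - X) ^ k)
  have hae : (fun y => heatKernel1 a t x y * laguerre1 a k y) =ᵐ[gammaLaw a] fun y =>
      Real.Gamma (a + k + 1) / k.factorial * (heatKernel1 a t x y * umbral a y ((1 - X) ^ k)) := by
    filter_upwards [ae_gammaLaw a] with y hy
    rw [laguerre1_eq_umbral ha hy]; ring
  refine ⟨(h1.const_mul _).congr hae.symm, ?_⟩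
  have hsub : ((1 - X : ℝ[X]) ^ k).comp (C (1 - Real.exp (-t)) + C (Real.exp (-t)) * X) =
      Real.exp (-(t * k)) • (1 - X) ^ k := by
    rw [pow_comp, sub_comp, one_comp, X_comp, smul_eq_C_mul,
      show -(t * k) = k * (-t) by ring, Real.exp_nat_mul, C_pow, ← mul_pow, C_sub, C_1]
    congr 1; ring
  rw [integral_congr_ae hae, integral_const_mul, h2, hsub, map_smul, smul_eq_mul,
    laguerre1_eq_umbral ha hx]
  ring

open Polynomial in
/-- Every monomial is a linear combination of Laguerre polynomials: expand
`X ^ n = (1 - (1 - X)) ^ n`. -/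
lemma exists_pow_eq_sum_laguerre1 {a : ℝ} (ha : -1 < a) (n : ℕ) :
    ∃ c : ℕ → ℝ, ∀ x : ℝ, 0 < x → x ^ n = ∑ i ∈ Finset.range (n + 1), c i * laguerre1 a i x := by
  have hG : ∀ i : ℕ, Real.Gamma (a + i + 1) ≠ 0 := fun i => by
    have : (0 : ℝ) ≤ i := i.cast_nonneg
    exact (Real.Gamma_pos_of_pos (by linarith)).ne'
  refine ⟨fun i => Real.Gamma (a + n + 1) * ((-1) ^ i * n.choose i) *
    (i.factorial / Real.Gamma (a + i + 1)), fun x hx => ?_⟩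
  have hX : (X : ℝ[X]) ^ n =
      ∑ i ∈ Finset.range (n + 1), ((-1) ^ i * (n.choose i : ℝ)) • (1 - X) ^ i := by
    conv_lhs => rw [show (X : ℝ[X]) = -(1 - X) + 1 by ring, add_pow]
    refine Finset.sum_congr rfl fun i _ => ?_
    rw [neg_pow, one_pow, smul_eq_C_mul, C_mul, C_pow, C_neg, C_1, C_eq_natCast]; ring
  have h := umbral_X_pow a x n
  rw [hX, map_sum, eq_div_iff (hG n), Finset.sum_mul] at h
  rw [← h]
  refine Finset.sum_congr rfl fun i _ => ?_
  have h1 := hG i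
  have h2 : (i.factorial : ℝ) ≠ 0 := by positivity
  rw [laguerre1_eq_umbral ha hx, map_smul, smul_eq_mul]
  field_simp

open Polynomial in
lemma integrable_laguerre1 {a : ℝ} (ha : -1 < a) (k : ℕ) : Integrable (laguerre1 a k) (gammaLaw a) := by
  have hP : ∀ P : ℝ[X], Integrable (fun y => umbral a y P) (gammaLaw a) := fun P => by
    induction P using Polynomial.induction_on' with
    | add p q hp hq => simp only [map_add]; exact hp.add hq
    | monomial j c =>
      rw [← smul_X_eq_monomial]
      simp only [map_smul, smul_eq_mul, umbral_X_pow]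
      have := integrable_gammaLaw_pow_mul_exp ha zero_lt_one j
      simp only [zero_mul, Real.exp_zero, mul_one] at this
      exact (this.div_const _).const_mul _
  refine ((hP ((1 - X) ^ k)).const_mul (Real.Gamma (a + k + 1) / k.factorial)).congr ?_
  filter_upwards [ae_gammaLaw a] with y hy
  rw [laguerre1_eq_umbral ha hy]

variable {d : ℕ} {α : Fin d → ℝ}

/-! ### The heat kernel in several variables -/

lemma heatKernel_nonneg (hα : ∀ i, -1 < α i) {t : ℝ} (ht : 0 < t) {x y : Fin d → ℝ}
    (hx : ∀ i, 0 < x i) (hy : ∀ i, 0 < y i) : 0 ≤ heatKernel α t x y := by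
  rw [heatKernel_eq_prod]
  exact Finset.prod_nonneg fun j _ => heatKernel1_nonneg (hα j) ht (hx j) (hy j)

lemma integrable_laguerre (hα : ∀ i, -1 < α i) (k : Fin d → ℕ) :
    Integrable (laguerre α k) (laguerreMeasure α) := by
  have := fun i => isProbabilityMeasure_gammaLaw (hα i)
  rw [laguerreMeasure_eq_pi hα]
  exact Integrable.fintype_prod fun i => integrable_laguerre1 (hα i) (k i)

lemma heatKernel_mul_laguerre (α : Fin d → ℝ) (t : ℝ) (k : Fin d → ℕ) (x y : Fin d → ℝ) :
    heatKernel α t x y * laguerre α k y =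
      ∏ i, heatKernel1 (α i) t (x i) (y i) * laguerre1 (α i) (k i) (y i) := by
  rw [Finset.prod_mul_distrib, heatKernel_eq_prod, laguerre]

lemma integrable_heatKernel_mul_laguerre (hα : ∀ i, -1 < α i) {t : ℝ} (ht : 0 < t)
    (k : Fin d → ℕ) {x : Fin d → ℝ} (hx : ∀ i, 0 < x i) :
    Integrable (fun y => heatKernel α t x y * laguerre α k y) (laguerreMeasure α) := by
  have := fun i => isProbabilityMeasure_gammaLaw (hα i)
  rw [laguerreMeasure_eq_pi hα]
  simp_rw [heatKernel_mul_laguerre]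
  exact Integrable.fintype_prod_dep fun i => (heatKernel1_laguerre1 (hα i) ht (hx i) (k i)).1

/-- The Laguerre polynomials are eigenfunctions of the heat semigroup. -/
lemma integral_heatKernel_mul_laguerre (hα : ∀ i, -1 < α i) {t : ℝ} (ht : 0 < t)
    (k : Fin d → ℕ) {x : Fin d → ℝ} (hx : ∀ i, 0 < x i) :
    ∫ y, heatKernel α t x y * laguerre α k y ∂laguerreMeasure α =
      Real.exp (-(t * (∑ i, k i : ℕ))) * laguerre α k x := by
  have := fun i => isProbabilityMeasure_gammaLaw (hα i)
  rw [laguerreMeasure_eq_pi hα]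
  simp_rw [heatKernel_mul_laguerre]
  rw [integral_fintype_prod_eq_prod (f := fun i y =>
    heatKernel1 (α i) t (x i) y * laguerre1 (α i) (k i) y),
    Finset.prod_congr rfl fun i _ => (heatKernel1_laguerre1 (hα i) ht (hx i) (k i)).2,
    Finset.prod_mul_distrib, ← Real.exp_sum, laguerre]
  congr 2
  rw [Finset.sum_neg_distrib, ← Finset.mul_sum]; push_cast; rfl

lemma laguerre_zero (hα : ∀ i, -1 < α i) {x : Fin d → ℝ} (hx : ∀ i, 0 < x i) :
    laguerre α 0 x = 1 := by
  refine Finset.prod_eq_one fun i _ => ?_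
  have h := (Real.Gamma_pos_of_pos (show 0 < α i + 1 by linarith [hα i])).ne'
  have h0 := umbral_X_pow (α i) (x i) 0
  simp only [pow_zero, Nat.cast_zero, add_zero] at h0
  rw [Pi.zero_apply, laguerre1_eq_umbral (hα i) (hx i), pow_zero, h0]
  simp [h]

lemma integrable_heatKernel (hα : ∀ i, -1 < α i) {t : ℝ} (ht : 0 < t) {x : Fin d → ℝ}
    (hx : ∀ i, 0 < x i) : Integrable (heatKernel α t x) (laguerreMeasure α) := by
  refine (integrable_heatKernel_mul_laguerre hα ht 0 hx).congr ?_
  filter_upwards [ae_laguerreMeasure α] with y hy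
  rw [laguerre_zero hα hy, mul_one]

/-- The heat kernel is a Markov kernel. -/
lemma integral_heatKernel (hα : ∀ i, -1 < α i) {t : ℝ} (ht : 0 < t) {x : Fin d → ℝ}
    (hx : ∀ i, 0 < x i) : ∫ y, heatKernel α t x y ∂laguerreMeasure α = 1 := by
  have h := integral_heatKernel_mul_laguerre hα ht 0 hx
  rw [laguerre_zero hα hx] at h
  simp only [Pi.zero_apply, Finset.sum_const_zero, Nat.cast_zero, mul_zero, neg_zero,
    Real.exp_zero, mul_one] at h
  rw [← h]
  refine integral_congr_ae ?_
  filter_upwards [ae_laguerreMeasure α] with y hy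
  rw [laguerre_zero hα hy, mul_one]

/-! ### Measurability -/

lemma measurable_besselI (ν : ℝ) : Measurable (besselI ν) :=
  Measurable.tsum fun m => by fun_prop

lemma measurable_heatKernel (α : Fin d → ℝ) :
    Measurable fun p : (ℝ × (Fin d → ℝ)) × (Fin d → ℝ) => heatKernel α p.1.1 p.1.2 p.2 := by
  unfold heatKernel
  refine Finset.measurable_prod _ fun j _ => ?_
  have := measurable_besselI (α j)
  fun_prop

lemma measurable_heatSemigroup (hα : ∀ i, -1 < α i) {f : (Fin d → ℝ) → ℝ}
    (hf : AEStronglyMeasurable f (laguerreMeasure α)) :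
    Measurable fun p : ℝ × (Fin d → ℝ) => heatSemigroup α p.1 f p.2 := by
  have := isProbabilityMeasure_laguerreMeasure hα
  have he : (fun p : ℝ × (Fin d → ℝ) => heatSemigroup α p.1 f p.2) =
      fun p => ∫ y, heatKernel α p.1 p.2 y * hf.mk f y ∂laguerreMeasure α := by
    ext p
    refine integral_congr_ae ?_
    filter_upwards [hf.ae_eq_mk] with y hy
    rw [hy]
  rw [he]
  exact ((measurable_heatKernel α).mul
    (hf.stronglyMeasurable_mk.measurable.comp measurable_snd)).stronglyMeasurable.integral_prod_right'
    |>.measurable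

/-! ### Completeness of the Laguerre polynomials -/

/-- `f` represents an element of the ball of radius `M` of `L^∞(μ_α)`. -/
def BddBy (α : Fin d → ℝ) (M : ℝ) (f : (Fin d → ℝ) → ℝ) : Prop :=
  AEStronglyMeasurable f (laguerreMeasure α) ∧ ∀ᵐ x ∂laguerreMeasure α, |f x| ≤ M

lemma BddBy.integrable_mul {M : ℝ} {f g : (Fin d → ℝ) → ℝ} (hf : BddBy α M f)
    (hg : Integrable g (laguerreMeasure α)) :
    Integrable (fun x => f x * g x) (laguerreMeasure α) :=
  hg.bdd_mul hf.1 hf.2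

lemma BddBy.nonneg (hα : ∀ i, -1 < α i) {M : ℝ} {f : (Fin d → ℝ) → ℝ} (hf : BddBy α M f) :
    0 ≤ M := by
  have := isProbabilityMeasure_laguerreMeasure hα
  obtain ⟨x, hx⟩ := hf.2.exists
  exact (abs_nonneg _).trans hx

/-- The Laguerre coefficient of index `k`, not normalized. -/
def coeff (α : Fin d → ℝ) (k : Fin d → ℕ) (f : (Fin d → ℝ) → ℝ) : ℝ :=
  ∫ x, f x * laguerre α k x ∂laguerreMeasure α

lemma coeff_const_mul (k : Fin d → ℕ) (c : ℝ) (f : (Fin d → ℝ) → ℝ) :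
    coeff α k (fun x => c * f x) = c * coeff α k f := by
  simp only [coeff, mul_assoc, integral_const_mul]

lemma integral_mul_monomial_eq_zero (hα : ∀ i, -1 < α i) {M : ℝ} {f : (Fin d → ℝ) → ℝ}
    (hf : BddBy α M f) (h0 : ∀ k, coeff α k f = 0) (n : Fin d → ℕ) :
    ∫ x, f x * ∏ i, x i ^ n i ∂laguerreMeasure α = 0 := by
  choose c hc using fun i => exists_pow_eq_sum_laguerre1 (hα i) (n i)
  have hae : (fun x => f x * ∏ i, x i ^ n i) =ᵐ[laguerreMeasure α] fun x =>
      ∑ k ∈ Fintype.piFinset fun i => Finset.range (n i + 1),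
        (∏ i, c i (k i)) * (f x * laguerre α k x) := by
    filter_upwards [ae_laguerreMeasure α] with x hx
    rw [Finset.prod_congr rfl fun i _ => hc i (x i) (hx i), Finset.prod_univ_sum, Finset.mul_sum]
    refine Finset.sum_congr rfl fun k _ => ?_
    rw [Finset.prod_mul_distrib, laguerre]; ring
  rw [integral_congr_ae hae, integral_finsetSum _ fun k _ =>
    (hf.integrable_mul (integrable_laguerre hα k)).const_mul _]
  refine Finset.sum_eq_zero fun k _ => ?_
  have := h0 k
  rw [coeff] at this
  rw [integral_const_mul, this, mul_zero]

lemma integrable_poly_mul_exp (hα : ∀ i, -1 < α i) (p : MvPolynomial (Fin d) ℝ) {w : Fin d → ℝ}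
    (hw : ∀ i, w i < 1) :
    Integrable (fun x => MvPolynomial.eval x p * Real.exp (∑ i, w i * x i))
      (laguerreMeasure α) := by
  have := fun i => isProbabilityMeasure_gammaLaw (hα i)
  induction p using MvPolynomial.induction_on' with
  | monomial u a =>
    have h := Integrable.fintype_prod fun i =>
      integrable_gammaLaw_pow_mul_exp (hα i) (hw i) (u i)
    rw [← laguerreMeasure_eq_pi hα] at h
    refine (h.const_mul a).congr (ae_of_all _ fun x => ?_)
    simp only [MvPolynomial.eval_monomial, Finset.prod_mul_distrib, Real.exp_sum,
      Finsupp.prod_fintype _ _ fun i => pow_zero (x i)]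
    ring
  | add p q hp hq => simp only [map_add, add_mul]; exact hp.add hq

lemma integral_mul_poly_eq_zero (hα : ∀ i, -1 < α i) {M : ℝ} {f : (Fin d → ℝ) → ℝ}
    (hf : BddBy α M f) (h0 : ∀ k, coeff α k f = 0) (p : MvPolynomial (Fin d) ℝ) :
    ∫ x, f x * MvPolynomial.eval x p ∂laguerreMeasure α = 0 := by
  have hint : ∀ p : MvPolynomial (Fin d) ℝ,
      Integrable (fun x => f x * MvPolynomial.eval x p) (laguerreMeasure α) := fun p =>
    hf.integrable_mul (by simpa using integrable_poly_mul_exp hα p (w := 0) (by simp))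
  induction p using MvPolynomial.induction_on' with
  | monomial u a =>
    have h := integral_mul_monomial_eq_zero hα hf h0 u
    simp only [MvPolynomial.eval_monomial, Finsupp.prod_fintype _ _ fun i => pow_zero _,
      mul_left_comm _ a]
    rw [integral_const_mul, h, mul_zero]
  | add p q hp hq =>
    simp only [map_add, mul_add]
    rw [integral_add (hint p) (hint q), hp, hq, add_zero]

/-- Orthogonality to polynomials times an exponential passes to a slightly faster exponential, by
expanding the additional exponential factor into its power series. -/
lemma integral_mul_poly_mul_exp_step (hα : ∀ i, -1 < α i) {M : ℝ} {f : (Fin d → ℝ) → ℝ}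
    (hf : BddBy α M f) {v w : Fin d → ℝ} (hv : ∀ i, 0 ≤ v i) (hw0 : ∀ i, 0 ≤ w i)
    (hw1 : ∀ i, w i < 1)
    (h : ∀ p : MvPolynomial (Fin d) ℝ, ∫ x, f x * (MvPolynomial.eval x p *
      Real.exp (-∑ i, v i * x i)) ∂laguerreMeasure α = 0) (p : MvPolynomial (Fin d) ℝ) :
    ∫ x, f x * (MvPolynomial.eval x p * Real.exp (-∑ i, (v i + w i) * x i))
      ∂laguerreMeasure α = 0 := by
  set ℓ : MvPolynomial (Fin d) ℝ := ∑ i, MvPolynomial.C (w i) * MvPolynomial.X i with hℓ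
  have hev : ∀ x, MvPolynomial.eval x ℓ = ∑ i, w i * x i := fun x => by simp [hℓ]
  set F : ℕ → (Fin d → ℝ) → ℝ := fun r x => f x * (MvPolynomial.eval x
    (MvPolynomial.C ((r.factorial : ℝ)⁻¹) * (p * (-ℓ) ^ r)) * Real.exp (-∑ i, v i * x i)) with hF
  have hexp : ∀ z : ℝ, HasSum (fun r : ℕ => z ^ r / r.factorial) (Real.exp z) := fun z => by
    have := NormedSpace.expSeries_div_hasSum_exp (𝔸 := ℝ) z
    rwa [← Real.exp_eq_exp_ℝ] at this
  have hmE : Measurable fun x : Fin d → ℝ => Real.exp (-∑ i, v i * x i) := by fun_prop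
  have hmp : ∀ q : MvPolynomial (Fin d) ℝ, Measurable fun x : Fin d → ℝ => MvPolynomial.eval x q :=
    fun q => (MvPolynomial.continuous_eval q).measurable
  have hsum := hasSum_integral_of_dominated_convergence (μ := laguerreMeasure α) (F := F)
    (f := fun x => f x * (MvPolynomial.eval x p * Real.exp (-∑ i, (v i + w i) * x i)))
    (fun r x => M * |MvPolynomial.eval x p| * ((∑ i, w i * x i) ^ r / r.factorial))
    (fun r => hf.1.mul ((hmp _).mul hmE).aestronglyMeasurable) (fun r => ?_)
    (ae_of_all _ fun x => (hexp _).summable.mul_left _) ?_ (ae_of_all _ fun x => ?_)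
  · have h0 : (fun r => ∫ x, F r x ∂laguerreMeasure α) = fun _ => 0 := by
      ext r; exact h _
    rw [h0] at hsum
    exact hsum.unique hasSum_zero
  · filter_upwards [hf.2, ae_laguerreMeasure α] with x hx hpos
    have hl : 0 ≤ ∑ i, w i * x i :=
      Finset.sum_nonneg fun i _ => mul_nonneg (hw0 i) (hpos i).le
    have hE : Real.exp (-∑ i, v i * x i) ≤ 1 := by
      rw [Real.exp_le_one_iff, neg_nonpos]
      exact Finset.sum_nonneg fun i _ => mul_nonneg (hv i) (hpos i).le
    simp only [hF, Real.norm_eq_abs, map_mul, MvPolynomial.eval_C, map_pow, map_neg, hev, abs_mul,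
      abs_pow, abs_neg, abs_of_nonneg hl, Real.abs_exp, abs_inv, Nat.abs_cast]
    have hM : 0 ≤ M := (abs_nonneg _).trans hx
    calc _ ≤ M * ((r.factorial : ℝ)⁻¹ * (|MvPolynomial.eval x p| * (∑ i, w i * x i) ^ r) * 1) := by
          gcongr
      _ = _ := by ring
  · have := ((integrable_poly_mul_exp hα p hw1).norm.const_mul M)
    refine this.congr (ae_of_all _ fun x => ?_)
    simp only [Real.norm_eq_abs, abs_mul, Real.abs_exp]
    rw [tsum_mul_left, (hexp _).tsum_eq, mul_assoc]
  · have h1 : Real.exp (-∑ i, (v i + w i) * x i) =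
        Real.exp (-∑ i, v i * x i) * Real.exp (-∑ i, w i * x i) := by
      rw [← Real.exp_add]; simp only [add_mul, Finset.sum_add_distrib]; ring_nf
    simp only [h1, hF]
    refine HasSum.of_eq ((hexp (-∑ i, w i * x i)).mul_left
      (f x * MvPolynomial.eval x p * Real.exp (-∑ i, v i * x i))) (fun r => ?_) (by ring)
    simp only [map_mul, MvPolynomial.eval_C, map_pow, map_neg, hev]
    ring

lemma integral_mul_exp_eq_zero (hα : ∀ i, -1 < α i) {M : ℝ} {f : (Fin d → ℝ) → ℝ}
    (hf : BddBy α M f) (h0 : ∀ k, coeff α k f = 0) (n : Fin d → ℕ) :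
    ∫ x, f x * Real.exp (-∑ i, n i * x i) ∂laguerreMeasure α = 0 := by
  -- Each of the `N` factors `exp (-∑ (n i / N) x i)` decays slowly enough for its power series to
  -- converge dominatedly under the Gamma tails of the measure.
  set N : ℕ := ∑ i, n i + 1 with hN
  have hN0 : (0 : ℝ) < N := by positivity
  have hw1 : ∀ i, (n i : ℝ) / N < 1 := fun i => by
    rw [div_lt_one hN0]
    exact_mod_cast Nat.lt_succ_of_le
      (Finset.single_le_sum (f := n) (fun _ _ => Nat.zero_le _) (Finset.mem_univ i))
  have key : ∀ (m : ℕ) (p : MvPolynomial (Fin d) ℝ), ∫ x, f x * (MvPolynomial.eval x p *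
      Real.exp (-∑ i, (m * ((n i : ℝ) / N)) * x i)) ∂laguerreMeasure α = 0 := by
    intro m
    induction m with
    | zero => simpa using integral_mul_poly_eq_zero hα hf h0
    | succ m ih =>
      have := integral_mul_poly_mul_exp_step hα hf (v := fun i => m * ((n i : ℝ) / N))
        (w := fun i => (n i : ℝ) / N) (fun i => by positivity) (fun i => by positivity) hw1 ih
      simpa only [Nat.cast_succ, add_mul, one_mul] using this
  have := key N 1
  simpa [mul_div_cancel₀ _ hN0.ne'] using this

/-- A bounded, continuous, injective function on the line that is `e ^ (-y)` for `y ≥ 0`. -/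
def expCoord (y : ℝ) : ℝ := Real.exp (-max y 0) + (1 - Real.exp (min y 0))

lemma expCoord_of_pos {y : ℝ} (hy : 0 < y) : expCoord y = Real.exp (-y) := by
  simp [expCoord, hy.le]

lemma continuous_expCoord : Continuous expCoord := by unfold expCoord; fun_prop

lemma expCoord_injective : Function.Injective expCoord := by
  have : StrictAnti expCoord := fun x y hxy => by
    unfold expCoord
    rcases le_or_gt 0 x with hx | hx
    · have h1 : Real.exp (-max y 0) < Real.exp (-max x 0) := by
        rw [max_eq_left hx, max_eq_left (hx.trans hxy.le)]
        exact Real.exp_lt_exp.2 (by linarith)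
      rw [min_eq_right hx, min_eq_right (hx.trans hxy.le)]; linarith
    · have h1 : Real.exp (-max y 0) ≤ Real.exp (-max x 0) :=
        Real.exp_le_exp.2 (neg_le_neg (max_le_max hxy.le le_rfl))
      have h2 : Real.exp (min x 0) < Real.exp (min y 0) :=
        Real.exp_lt_exp.2 (by rw [min_eq_left hx.le]; exact lt_min hxy hx)
      linarith
  exact this.injective

lemma norm_expCoord_le (y : ℝ) : ‖expCoord y‖ ≤ 2 := by
  have h1 : Real.exp (-max y 0) ≤ 1 := by simp
  have h2 : Real.exp (min y 0) ≤ 1 := by simp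
  have h3 := Real.exp_pos (-max y 0)
  have h4 := Real.exp_pos (min y 0)
  rw [Real.norm_eq_abs, abs_le]
  unfold expCoord
  constructor <;> linarith

open BoundedContinuousFunction in
/-- The coordinates `x ↦ ψ (x i)`, with `ψ = expCoord`, as bounded continuous functions. -/
def expCoordFun (i : Fin d) : (Fin d → ℝ) →ᵇ ℝ :=
  BoundedContinuousFunction.ofNormedAddCommGroup (fun x => expCoord (x i))
    (continuous_expCoord.comp (continuous_apply i)) 2 fun x => norm_expCoord_le (x i)

open BoundedContinuousFunction in
/-- The algebra generated by the functions `x ↦ ψ (x i)`. -/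
def expAlgebra (d : ℕ) : StarSubalgebra ℝ ((Fin d → ℝ) →ᵇ ℝ) where
  toSubalgebra := (MvPolynomial.aeval (R := ℝ) (expCoordFun (d := d))).range
  star_mem' := by
    intro a ha
    have : star a = a := by ext x; simp
    rwa [this]

lemma expAlgebra_separatesPoints : ((expAlgebra d).map
    (BoundedContinuousFunction.toContinuousMapStarₐ ℝ)).SeparatesPoints := by
  intro x y hxy
  obtain ⟨i, hi⟩ := Function.ne_iff.1 hxy
  refine ⟨fun z => expCoord (z i), ?_, fun h => hi (expCoord_injective h)⟩
  refine ⟨BoundedContinuousFunction.toContinuousMapStarₐ ℝ (expCoordFun i), ?_, rfl⟩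
  exact ⟨expCoordFun i, ⟨MvPolynomial.X i, by simp⟩, rfl⟩

lemma aeval_expCoordFun_apply (p : MvPolynomial (Fin d) ℝ) (x : Fin d → ℝ) :
    MvPolynomial.aeval (expCoordFun (d := d)) p x =
      MvPolynomial.eval (fun i => expCoord (x i)) p := by
  induction p using MvPolynomial.induction_on with
  | C a => simp [BoundedContinuousFunction.algebraMap_apply]
  | add p q hp hq => simp [hp, hq]
  | mul_X p i hp => simp [hp]; left; rfl

/-- **Completeness**: a bounded function all of whose Laguerre coefficients vanish is zero. -/
theorem ae_eq_zero_of_coeff_eq_zero (hα : ∀ i, -1 < α i) {M : ℝ} {f : (Fin d → ℝ) → ℝ}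
    (hf : BddBy α M f) (h0 : ∀ k, coeff α k f = 0) : f =ᵐ[laguerreMeasure α] 0 := by
  have := isProbabilityMeasure_laguerreMeasure hα
  have hpoly : ∀ p : MvPolynomial (Fin d) ℝ, ∫ x, f x *
      MvPolynomial.aeval (expCoordFun (d := d)) p x ∂laguerreMeasure α = 0 := fun p => by
    have hb : ∀ p : MvPolynomial (Fin d) ℝ, Integrable (fun x => f x *
        MvPolynomial.aeval (expCoordFun (d := d)) p x) (laguerreMeasure α) := fun p =>
      hf.integrable_mul (BoundedContinuousFunction.integrable _ _)
    induction p using MvPolynomial.induction_on' with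
    | monomial u a =>
      have hae : (fun x => f x * MvPolynomial.aeval (expCoordFun (d := d))
          (MvPolynomial.monomial u a) x) =ᵐ[laguerreMeasure α]
          fun x => a * (f x * Real.exp (-∑ i, u i * x i)) := by
        filter_upwards [ae_laguerreMeasure α] with x hx
        rw [aeval_expCoordFun_apply, MvPolynomial.eval_monomial,
          Finsupp.prod_fintype _ _ fun i => pow_zero _, ← Finset.sum_neg_distrib, Real.exp_sum,
          Finset.prod_congr rfl fun i _ => ?_]
        · ring
        · rw [expCoord_of_pos (hx i), ← Real.exp_nat_mul, mul_neg]
      rw [integral_congr_ae hae, integral_const_mul, integral_mul_exp_eq_zero hα hf h0, mul_zero]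
    | add p q hp hq =>
      simp only [map_add, BoundedContinuousFunction.add_apply, mul_add]
      rw [integral_add (hb p) (hb q), hp, hq, add_zero]
  -- `f + M` and `M` are densities of measures that agree on a separating algebra.
  have hM := hf.nonneg hα
  have hfi : Integrable f (laguerreMeasure α) := by
    simpa using hf.integrable_mul (integrable_const (1 : ℝ))
  have hsum : Integrable (fun x => f x + M) (laguerreMeasure α) := hfi.add (integrable_const M)
  have hme : AEMeasurable (fun x => ENNReal.ofReal (f x + M)) (laguerreMeasure α) :=
    hsum.aemeasurable.ennreal_ofReal
  have i1 := isFiniteMeasure_withDensity_ofReal hsum.2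
  have i2 := isFiniteMeasure_withDensity_ofReal (integrable_const (μ := laguerreMeasure α) M).2
  have heq : (laguerreMeasure α).withDensity (fun x => ENNReal.ofReal (f x + M)) =
      (laguerreMeasure α).withDensity (fun _ => ENNReal.ofReal M) := by
    refine ext_of_forall_mem_subalgebra_integral_eq_of_pseudoEMetric_complete_countable
      (𝕜 := ℝ) (A := expAlgebra d) expAlgebra_separatesPoints ?_
    rintro _ ⟨p, rfl⟩
    change ∫ x, MvPolynomial.aeval (expCoordFun (d := d)) p x ∂_ =
      ∫ x, MvPolynomial.aeval (expCoordFun (d := d)) p x ∂_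
    set g := MvPolynomial.aeval (expCoordFun (d := d)) p with hg
    rw [integral_withDensity_eq_integral_toReal_smul₀ hme (by simp),
      integral_withDensity_eq_integral_toReal_smul₀ (by fun_prop) (by simp)]
    have h1 : ∫ x, (ENNReal.ofReal (f x + M)).toReal • g x ∂laguerreMeasure α =
        ∫ x, (f x * g x + M * g x) ∂laguerreMeasure α := by
      refine integral_congr_ae ?_
      filter_upwards [hf.2] with x hx
      rw [ENNReal.toReal_ofReal (by linarith [neg_abs_le (f x)]), smul_eq_mul, add_mul]
    have hgi : Integrable (fun x => g x) (laguerreMeasure α) :=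
      BoundedContinuousFunction.integrable _ _
    rw [h1, integral_add (hf.integrable_mul hgi) (hgi.const_mul M), hpoly p, zero_add]
    simp [ENNReal.toReal_ofReal hM]
  rw [withDensity_eq_iff hme (by fun_prop)] at heq
  · filter_upwards [heq, hf.2] with x hx hb
    rw [ENNReal.ofReal_eq_ofReal_iff (by linarith [neg_abs_le (f x)]) hM] at hx
    simpa using hx
  · rw [← ofReal_integral_eq_lintegral_ofReal hsum]
    · simp
    · filter_upwards [hf.2] with x hx
      simpa using by linarith [neg_abs_le (f x)]

/-! ### Laplace transforms of bounded functions with power weights -/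

/-- The Laplace transform at `τ` of `r ^ p ψ(r)`. -/
def powLaplace (ψ : ℝ → ℝ) (p τ : ℝ) : ℝ :=
  ∫ r in Ioi (0 : ℝ), r ^ p * Real.exp (-(τ * r)) * ψ r

lemma integrableOn_rpow_mul_exp {p τ : ℝ} (hp : -1 < p) (hτ : 0 < τ) :
    IntegrableOn (fun r : ℝ => r ^ p * Real.exp (-(τ * r))) (Ioi 0) := by
  have := integrableOn_rpow_mul_exp_neg_mul_rpow (p := 1) (s := p) (b := τ) hp one_pos hτ
  simp only [Real.rpow_one, neg_mul] at this
  exact this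

lemma integrableOn_powLaplace {ψ : ℝ → ℝ} (hψ : Measurable ψ) {M : ℝ}
    (hM : ∀ r, 0 < r → |ψ r| ≤ M) {p τ : ℝ} (hp : -1 < p) (hτ : 0 < τ) :
    IntegrableOn (fun r : ℝ => r ^ p * Real.exp (-(τ * r)) * ψ r) (Ioi 0) := by
  refine Integrable.mul_bdd (c := M) (integrableOn_rpow_mul_exp hp hτ)
    hψ.aestronglyMeasurable ?_
  filter_upwards [ae_restrict_mem measurableSet_Ioi] with r hr using hM r hr

lemma abs_powLaplace_le {ψ : ℝ → ℝ} {M : ℝ} (hM : ∀ r, 0 < r → |ψ r| ≤ M) {p τ : ℝ}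
    (hp : -1 < p) (hτ : 0 < τ) :
    |powLaplace ψ p τ| ≤ M * ((1 / τ) ^ (p + 1) * Real.Gamma (p + 1)) := by
  have h := Real.integral_rpow_mul_exp_neg_mul_Ioi (a := p + 1) (by linarith) hτ
  rw [add_sub_cancel_right] at h
  rw [← h, ← integral_const_mul, powLaplace, ← Real.norm_eq_abs]
  refine norm_integral_le_of_norm_le ((integrableOn_rpow_mul_exp hp hτ).const_mul M) ?_
  filter_upwards [ae_restrict_mem measurableSet_Ioi] with r hr
  have hr0 : (0 : ℝ) < r := hr
  have h0 : 0 ≤ r ^ p * Real.exp (-(τ * r)) := by positivity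
  rw [Real.norm_eq_abs, abs_mul, abs_of_nonneg h0, mul_comm M]
  exact mul_le_mul_of_nonneg_left (hM r hr) h0

lemma hasDerivAt_powLaplace {ψ : ℝ → ℝ} (hψ : Measurable ψ) {M : ℝ}
    (hM : ∀ r, 0 < r → |ψ r| ≤ M) {p τ : ℝ} (hp : -1 < p) (hτ : 0 < τ) :
    HasDerivAt (powLaplace ψ p) (-powLaplace ψ (p + 1) τ) τ := by
  have hM0 : 0 ≤ M := (abs_nonneg _).trans (hM 1 one_pos)
  have h := (hasDerivAt_integral_of_dominated_loc_of_deriv_le (μ := volume.restrict (Ioi (0 : ℝ)))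
    (F := fun σ r => r ^ p * Real.exp (-(σ * r)) * ψ r)
    (F' := fun σ r => -(r ^ (p + 1) * Real.exp (-(σ * r)) * ψ r)) (x₀ := τ) (s := Ioi (τ / 2))
    (bound := fun r => r ^ (p + 1) * Real.exp (-(τ / 2 * r)) * M)
    (Ioi_mem_nhds (by linarith)) (Filter.Eventually.of_forall fun σ => ?_)
    (integrableOn_powLaplace hψ hM hp hτ) ?_ ?_ ?_ ?_).2
  · rw [integral_neg] at h; exact h
  · exact Measurable.aestronglyMeasurable (by fun_prop)
  · exact Measurable.aestronglyMeasurable (by fun_prop)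
  · filter_upwards [ae_restrict_mem measurableSet_Ioi] with r hr σ hσ
    have hr0 : (0 : ℝ) < r := hr
    have hσ' : τ / 2 < σ := hσ
    rw [norm_neg, norm_mul, norm_mul, Real.norm_of_nonneg (Real.rpow_nonneg hr0.le _),
      Real.norm_of_nonneg (Real.exp_pos _).le, Real.norm_eq_abs]
    gcongr
    exact hM r hr
  · exact (integrableOn_rpow_mul_exp (by linarith) (by linarith)).mul_const M
  · filter_upwards [ae_restrict_mem measurableSet_Ioi] with r hr σ hσ
    have hr0 : (0 : ℝ) < r := hr
    have h1 : HasDerivAt (fun σ : ℝ => -(σ * r)) (-(1 * r)) σ := ((hasDerivAt_id σ).mul_const r).neg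
    have h2 := (h1.exp.const_mul (r ^ p)).mul_const (ψ r)
    refine h2.congr_deriv ?_
    rw [Real.rpow_add_one hr0.ne']; ring

/-! ### The subordination formula -/

lemma tendsto_gaussian_primitive_atTop :
    Filter.Tendsto (fun x : ℝ => ∫ w in (0 : ℝ)..x, Real.exp (-w ^ 2)) Filter.atTop
      (nhds (Real.sqrt Real.pi / 2)) := by
  have hi : IntegrableOn (fun w : ℝ => Real.exp (-w ^ 2)) (Ioi 0) := by
    simpa using (integrable_exp_neg_mul_sq one_pos).integrableOn (s := Ioi (0 : ℝ))
  have h := intervalIntegral_tendsto_integral_Ioi 0 hi Filter.tendsto_id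
  have he := integral_gaussian_Ioi 1
  simp only [neg_mul, one_mul, div_one] at he
  rw [he] at h
  exact h

lemma tendsto_gaussian_primitive_atBot :
    Filter.Tendsto (fun x : ℝ => ∫ w in (0 : ℝ)..x, Real.exp (-w ^ 2)) Filter.atBot
      (nhds (-(Real.sqrt Real.pi / 2))) := by
  have h := (tendsto_gaussian_primitive_atTop.comp Filter.tendsto_neg_atBot_atTop).neg
  refine h.congr fun x => ?_
  have := intervalIntegral.integral_comp_neg (a := 0) (b := x) (fun w : ℝ => Real.exp (-w ^ 2))
  simp only [even_two, Even.neg_pow, neg_zero] at this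
  rw [Function.comp_apply, this, intervalIntegral.integral_symm, neg_neg]

lemma hasDerivAt_gaussian_primitive (x : ℝ) :
    HasDerivAt (fun x : ℝ => ∫ w in (0 : ℝ)..x, Real.exp (-w ^ 2)) (Real.exp (-x ^ 2)) x := by
  have hc : Continuous fun w : ℝ => Real.exp (-w ^ 2) := by fun_prop
  exact intervalIntegral.integral_hasDerivAt_right (hc.intervalIntegrable _ _)
    (hc.stronglyMeasurableAtFilter _ _) hc.continuousAt

/-- The subordination formula, from the explicit primitive
`e^(2c) Φ(√u + c/√u) + e^(-2c) Φ(√u - c/√u)` of the integrand, `Φ` being a primitive of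
`e^(-w²)` and `z = 2c`. -/
lemma integral_subordination {z : ℝ} (hz : 0 ≤ z) :
    ∫ u in Ioi (0 : ℝ), Real.exp (-u) / Real.sqrt u * Real.exp (-(z ^ 2 / (4 * u))) =
      Real.sqrt Real.pi * Real.exp (-z) := by
  rcases hz.eq_or_lt with rfl | hz
  · have h := Real.Gamma_eq_integral (s := 1 / 2) (by norm_num)
    rw [Real.Gamma_one_half_eq] at h
    rw [neg_zero, Real.exp_zero, mul_one, h]
    refine setIntegral_congr_fun measurableSet_Ioi fun u hu => ?_
    have hu0 : (0 : ℝ) < u := hu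
    rw [show (1 / 2 - 1 : ℝ) = -(1 / 2) by norm_num, Real.rpow_neg hu0.le, ← Real.sqrt_eq_rpow]
    simp [div_eq_mul_inv]
  set c := z / 2 with hc
  have hc0 : 0 < c := by positivity
  set Φ : ℝ → ℝ := fun x : ℝ => ∫ w in (0 : ℝ)..x, Real.exp (-w ^ 2) with hΦ
  set A : ℝ → ℝ := fun u => Real.exp (2 * c) * Φ (Real.sqrt u + c / Real.sqrt u) +
    Real.exp (-(2 * c)) * Φ (Real.sqrt u - c / Real.sqrt u) with hA
  have hsqrt0 : Filter.Tendsto Real.sqrt (nhdsWithin 0 (Ioi 0)) (nhds 0) := by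
    have := (Real.continuous_sqrt.tendsto 0).mono_left (nhdsWithin_le_nhds (s := Ioi 0))
    rwa [Real.sqrt_zero] at this
  have hsqrt0' : Filter.Tendsto Real.sqrt (nhdsWithin 0 (Ioi 0)) (nhdsWithin 0 (Ioi 0)) :=
    tendsto_nhdsWithin_iff.2 ⟨hsqrt0, by
      filter_upwards [self_mem_nhdsWithin] with u hu using Real.sqrt_pos.2 hu⟩
  have hdiv0 : Filter.Tendsto (fun u => c / Real.sqrt u) (nhdsWithin 0 (Ioi 0)) Filter.atTop := by
    simp only [div_eq_mul_inv]
    exact (tendsto_inv_nhdsGT_zero.comp hsqrt0').const_mul_atTop hc0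
  have hdivT : Filter.Tendsto (fun u => c / Real.sqrt u) Filter.atTop (nhds 0) :=
    Filter.Tendsto.div_atTop tendsto_const_nhds Real.tendsto_sqrt_atTop
  have hA0 : Filter.Tendsto A (nhdsWithin 0 (Ioi 0)) (nhds (Real.exp (2 * c) *
      (Real.sqrt Real.pi / 2) + Real.exp (-(2 * c)) * (-(Real.sqrt Real.pi / 2)))) := by
    refine ((tendsto_gaussian_primitive_atTop.comp ?_).const_mul _).add
      ((tendsto_gaussian_primitive_atBot.comp ?_).const_mul _)
    · exact hsqrt0.add_atTop hdiv0
    · simp only [sub_eq_add_neg]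
      exact hsqrt0.add_atBot (Filter.tendsto_neg_atTop_atBot.comp hdiv0)
  have hAT : Filter.Tendsto A Filter.atTop (nhds (Real.exp (2 * c) *
      (Real.sqrt Real.pi / 2) + Real.exp (-(2 * c)) * (Real.sqrt Real.pi / 2))) := by
    refine ((tendsto_gaussian_primitive_atTop.comp ?_).const_mul _).add
      ((tendsto_gaussian_primitive_atTop.comp ?_).const_mul _)
    · exact Real.tendsto_sqrt_atTop.atTop_add hdivT
    · simp only [sub_eq_add_neg]
      exact Real.tendsto_sqrt_atTop.atTop_add hdivT.neg
  have hderiv : ∀ u ∈ Ioi (0 : ℝ), HasDerivAt A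
      (Real.exp (-u) / Real.sqrt u * Real.exp (-(z ^ 2 / (4 * u)))) u := fun u hu => by
    have hu0 : (0 : ℝ) < u := hu
    set s := Real.sqrt u with hs
    have hs0 : 0 < s := Real.sqrt_pos.2 hu0
    have hss : u = s ^ 2 := (Real.sq_sqrt hu0.le).symm
    have h1 : HasDerivAt Real.sqrt (1 / (2 * s)) u := Real.hasDerivAt_sqrt hu0.ne'
    have h2 : HasDerivAt (fun u => c / Real.sqrt u) ((0 * s - c * (1 / (2 * s))) / s ^ 2) u :=
      (hasDerivAt_const u c).div h1 hs0.ne'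
    have h3 := ((hasDerivAt_gaussian_primitive _).comp u (h1.add h2)).const_mul (Real.exp (2 * c))
    have h4 := ((hasDerivAt_gaussian_primitive _).comp u (h1.sub h2)).const_mul
      (Real.exp (-(2 * c)))
    refine (h3.add h4).congr_deriv ?_
    have e1 : Real.exp (2 * c) * Real.exp (-(s + c / s) ^ 2) =
        Real.exp (-u) * Real.exp (-(z ^ 2 / (4 * u))) := by
      rw [← Real.exp_add, ← Real.exp_add, hss]
      congr 1
      rw [hc]; field_simp; ring
    have e2 : Real.exp (-(2 * c)) * Real.exp (-(s - c / s) ^ 2) =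
        Real.exp (-u) * Real.exp (-(z ^ 2 / (4 * u))) := by
      rw [← Real.exp_add, ← Real.exp_add, hss]
      congr 1
      rw [hc]; field_simp; ring
    simp only [Pi.add_apply, Pi.sub_apply, ← hs]
    rw [← mul_assoc, ← mul_assoc, e1, e2]
    field_simp
    ring
  have hcont : ContinuousWithinAt (Function.update A 0 (Real.exp (2 * c) *
      (Real.sqrt Real.pi / 2) + Real.exp (-(2 * c)) * (-(Real.sqrt Real.pi / 2)))) (Ici 0) 0 := by
    rw [continuousWithinAt_update_same, Ici_sdiff_left]
    exact hA0
  have h := integral_Ioi_of_hasDerivAt_of_nonneg hcont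
    (g' := fun u => Real.exp (-u) / Real.sqrt u * Real.exp (-(z ^ 2 / (4 * u))))
    (fun u hu => (hderiv u hu).congr_of_eventuallyEq ?_) (fun u _ => by positivity)
    (hAT.congr' ?_)
  · rw [h, Function.update_self, show 2 * c = z by rw [hc]; ring]; ring
  · filter_upwards [Ioi_mem_nhds hu] with v hv
    rw [Function.update_of_ne (ne_of_gt hv)]
  · filter_upwards [Filter.eventually_gt_atTop 0] with v hv
    rw [Function.update_of_ne (ne_of_gt hv)]

/-! ### The semigroups on bounded functions -/

lemma abs_heatSemigroup_le (hα : ∀ i, -1 < α i) {M : ℝ} {f : (Fin d → ℝ) → ℝ}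
    (hf : BddBy α M f) {t : ℝ} (ht : 0 < t) {x : Fin d → ℝ} (hx : ∀ i, 0 < x i) :
    |heatSemigroup α t f x| ≤ M := by
  have h : ∫ y, heatKernel α t x y * M ∂laguerreMeasure α = M := by
    rw [integral_mul_const, integral_heatKernel hα ht hx, one_mul]
  rw [← Real.norm_eq_abs, ← h]
  refine norm_integral_le_of_norm_le ((integrable_heatKernel hα ht hx).mul_const M) ?_
  filter_upwards [hf.2, ae_laguerreMeasure α] with y hy hpos
  have h0 := heatKernel_nonneg hα ht hx hpos
  rw [norm_mul, Real.norm_of_nonneg h0]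
  exact mul_le_mul_of_nonneg_left hy h0

/-- The function whose power-weighted Laplace transforms give `P_t f(x)` and its derivatives. -/
def subordinand (α : Fin d → ℝ) (f : (Fin d → ℝ) → ℝ) (x : Fin d → ℝ) (r : ℝ) : ℝ :=
  heatSemigroup α (1 / (4 * r)) f x

lemma abs_subordinand_le (hα : ∀ i, -1 < α i) {M : ℝ} {f : (Fin d → ℝ) → ℝ} (hf : BddBy α M f)
    {x : Fin d → ℝ} (hx : ∀ i, 0 < x i) (r : ℝ) (hr : 0 < r) : |subordinand α f x r| ≤ M :=
  abs_heatSemigroup_le hα hf (by positivity) hx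

lemma measurable_subordinand (hα : ∀ i, -1 < α i) {M : ℝ} {f : (Fin d → ℝ) → ℝ}
    (hf : BddBy α M f) (x : Fin d → ℝ) : Measurable (subordinand α f x) :=
  (measurable_heatSemigroup hα hf.1).comp (g := fun p : ℝ × (Fin d → ℝ) => _)
    (f := fun r : ℝ => (1 / (4 * r), x)) (by fun_prop)

/-- The substitution `u = t² r` in the subordination integral. -/
lemma poissonSemigroup_eq (α : Fin d → ℝ) (f : (Fin d → ℝ) → ℝ) (x : Fin d → ℝ) {t : ℝ}
    (ht : 0 < t) : poissonSemigroup α t f x =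
      1 / Real.sqrt Real.pi * (t * powLaplace (subordinand α f x) (-1 / 2) (t ^ 2)) := by
  have h := integral_comp_mul_left_Ioi' (fun u => Real.exp (-u) / Real.sqrt u *
    heatSemigroup α (t ^ 2 / (4 * u)) f x) 0 (b := t ^ 2) (by positivity)
  rw [mul_zero] at h
  rw [poissonSemigroup, ← h, powLaplace, smul_eq_mul]
  congr 1
  rw [← integral_const_mul, ← integral_const_mul]
  refine setIntegral_congr_fun measurableSet_Ioi fun r hr => ?_
  have hr0 : (0 : ℝ) < r := hr
  have e1 : Real.sqrt (t ^ 2 * r) = t * Real.sqrt r := by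
    rw [Real.sqrt_mul (by positivity), Real.sqrt_sq ht.le]
  have e2 : r ^ (-1 / 2 : ℝ) = (Real.sqrt r)⁻¹ := by
    rw [show (-1 / 2 : ℝ) = -(1 / 2) by norm_num, Real.rpow_neg hr0.le, Real.sqrt_eq_rpow]
  have e3 : t ^ 2 / (4 * (t ^ 2 * r)) = 1 / (4 * r) := by field_simp
  have hs := Real.sqrt_pos.2 hr0
  simp only [e1, e2, e3, subordinand]
  field_simp

/-- The time derivative `∂_t P_t f(x)`, as an explicit integral. -/
def poissonDeriv (α : Fin d → ℝ) (t : ℝ) (f : (Fin d → ℝ) → ℝ) (x : Fin d → ℝ) : ℝ :=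
  1 / Real.sqrt Real.pi * (powLaplace (subordinand α f x) (-1 / 2) (t ^ 2) -
    2 * t ^ 2 * powLaplace (subordinand α f x) (1 / 2) (t ^ 2))

lemma hasDerivAt_poissonSemigroup (hα : ∀ i, -1 < α i) {M : ℝ} {f : (Fin d → ℝ) → ℝ}
    (hf : BddBy α M f) {x : Fin d → ℝ} (hx : ∀ i, 0 < x i) {t : ℝ} (ht : 0 < t) :
    HasDerivAt (fun s => poissonSemigroup α s f x) (poissonDeriv α t f x) t := by
  have h := hasDerivAt_powLaplace (measurable_subordinand hα hf x) (abs_subordinand_le hα hf hx)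
    (p := -1 / 2) (τ := t ^ 2) (by norm_num) (by positivity)
  have h0 : HasDerivAt (fun s => powLaplace (subordinand α f x) (-1 / 2) (s ^ 2))
      (-powLaplace (subordinand α f x) (-1 / 2 + 1) (t ^ 2) * ((2 : ℕ) * t ^ (2 - 1))) t :=
    HasDerivAt.comp (h := fun s : ℝ => s ^ 2) t h (hasDerivAt_pow 2 t)
  have h1 := ((hasDerivAt_id t).mul h0).const_mul (1 / Real.sqrt Real.pi)
  refine (h1.congr_of_eventuallyEq ?_).congr_deriv ?_
  · filter_upwards [Ioi_mem_nhds ht] with s hs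
    exact poissonSemigroup_eq α f x hs
  · rw [poissonDeriv, show (-1 / 2 + 1 : ℝ) = 1 / 2 by norm_num]
    simp only [id_eq]
    push_cast
    ring

lemma continuousAt_poissonDeriv (hα : ∀ i, -1 < α i) {M : ℝ} {f : (Fin d → ℝ) → ℝ}
    (hf : BddBy α M f) {x : Fin d → ℝ} (hx : ∀ i, 0 < x i) {t : ℝ} (ht : 0 < t) :
    ContinuousAt (fun s => poissonDeriv α s f x) t := by
  have h : ∀ p : ℝ, -1 < p →
      ContinuousAt (fun s => powLaplace (subordinand α f x) p (s ^ 2)) t := fun p hp =>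
    ContinuousAt.comp (f := fun s : ℝ => s ^ 2) (hasDerivAt_powLaplace
      (measurable_subordinand hα hf x) (abs_subordinand_le hα hf hx) hp
      (by positivity)).continuousAt (by fun_prop)
  unfold poissonDeriv
  have h1 := h (-1 / 2) (by norm_num)
  have h2 := h (1 / 2) (by norm_num)
  fun_prop

lemma abs_poissonSemigroup_le (hα : ∀ i, -1 < α i) {M : ℝ} {f : (Fin d → ℝ) → ℝ}
    (hf : BddBy α M f) {x : Fin d → ℝ} (hx : ∀ i, 0 < x i) {t : ℝ} (ht : 0 < t) :
    |poissonSemigroup α t f x| ≤ M := by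
  have h := abs_powLaplace_le (abs_subordinand_le hα hf hx) (p := -1 / 2) (τ := t ^ 2)
    (by norm_num) (by positivity)
  have e : (1 / t ^ 2) ^ (-1 / 2 + 1 : ℝ) = 1 / t := by
    rw [show (-1 / 2 + 1 : ℝ) = 1 / 2 by norm_num, ← Real.sqrt_eq_rpow, Real.sqrt_div' _ (by positivity),
      Real.sqrt_one, Real.sqrt_sq ht.le]
  rw [e, show (-1 / 2 + 1 : ℝ) = 1 / 2 by norm_num, Real.Gamma_one_half_eq] at h
  have hpi := Real.sqrt_pos.2 Real.pi_pos
  rw [poissonSemigroup_eq α f x ht, abs_mul, abs_mul, abs_of_pos (by positivity : 0 < 1 / √Real.pi),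
    abs_of_pos ht]
  calc _ ≤ 1 / √Real.pi * (t * (M * (1 / t * √Real.pi))) := by gcongr
    _ = M := by field_simp

lemma abs_poissonDeriv_le (hα : ∀ i, -1 < α i) {M : ℝ} {f : (Fin d → ℝ) → ℝ}
    (hf : BddBy α M f) {x : Fin d → ℝ} (hx : ∀ i, 0 < x i) {t : ℝ} (ht : 0 < t) :
    |poissonDeriv α t f x| ≤ 2 * M / t := by
  have h1 := abs_powLaplace_le (abs_subordinand_le hα hf hx) (p := -1 / 2) (τ := t ^ 2)
    (by norm_num) (by positivity)
  have h2 := abs_powLaplace_le (abs_subordinand_le hα hf hx) (p := 1 / 2) (τ := t ^ 2)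
    (by norm_num) (by positivity)
  have e0 : (1 / t ^ 2) ^ (1 / 2 : ℝ) = 1 / t := by
    rw [← Real.sqrt_eq_rpow, Real.sqrt_div' _ (by positivity), Real.sqrt_one, Real.sqrt_sq ht.le]
  have e1 : (1 / t ^ 2) ^ (1 / 2 + 1 : ℝ) = 1 / t * (1 / t ^ 2) := by
    rw [Real.rpow_add_one (by positivity), e0]
  rw [show (-1 / 2 + 1 : ℝ) = 1 / 2 by norm_num, e0, Real.Gamma_one_half_eq] at h1
  rw [e1, Real.Gamma_add_one (by norm_num), Real.Gamma_one_half_eq] at h2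
  have hpi := Real.sqrt_pos.2 Real.pi_pos
  rw [poissonDeriv, abs_mul, abs_of_pos (by positivity : 0 < 1 / √Real.pi)]
  calc _ ≤ 1 / √Real.pi * (M * (1 / t * √Real.pi) +
        2 * t ^ 2 * (M * (1 / t * (1 / t ^ 2) * (1 / 2 * √Real.pi)))) := by
        gcongr
        refine (abs_sub _ _).trans (add_le_add h1 ?_)
        rw [abs_mul, abs_of_pos (by positivity : 0 < 2 * t ^ 2)]
        gcongr
    _ = 2 * M / t := by field_simp; ring

lemma measurable_poissonSemigroup (hα : ∀ i, -1 < α i) {M : ℝ} {f : (Fin d → ℝ) → ℝ}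
    (hf : BddBy α M f) :
    Measurable fun p : ℝ × (Fin d → ℝ) => poissonSemigroup α p.1 f p.2 := by
  have h := measurable_heatSemigroup hα hf.1
  unfold poissonSemigroup
  refine Measurable.const_mul (StronglyMeasurable.measurable
    (StronglyMeasurable.integral_prod_right' (f := fun q : (ℝ × (Fin d → ℝ)) × ℝ =>
      Real.exp (-q.2) / Real.sqrt q.2 * heatSemigroup α (q.1.1 ^ 2 / (4 * q.2)) f q.1.2)
      (Measurable.stronglyMeasurable ?_))) _
  refine Measurable.mul (by fun_prop) ?_
  exact h.comp (f := fun q : (ℝ × (Fin d → ℝ)) × ℝ => (q.1.1 ^ 2 / (4 * q.2), q.1.2)) (by fun_prop)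

lemma measurable_poissonDeriv (hα : ∀ i, -1 < α i) {M : ℝ} {f : (Fin d → ℝ) → ℝ}
    (hf : BddBy α M f) :
    Measurable fun p : ℝ × (Fin d → ℝ) => poissonDeriv α p.1 f p.2 := by
  have h := measurable_heatSemigroup hα hf.1
  have hL : ∀ q : ℝ, Measurable fun p : ℝ × (Fin d → ℝ) =>
      powLaplace (subordinand α f p.2) q (p.1 ^ 2) := fun q => by
    refine StronglyMeasurable.measurable
      (StronglyMeasurable.integral_prod_right' (f := fun z : (ℝ × (Fin d → ℝ)) × ℝ =>
        z.2 ^ q * Real.exp (-(z.1.1 ^ 2 * z.2)) * subordinand α f z.1.2 z.2)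
        (Measurable.stronglyMeasurable ?_))
    refine Measurable.mul (by fun_prop) ?_
    exact h.comp (f := fun z : (ℝ × (Fin d → ℝ)) × ℝ => (1 / (4 * z.2), z.1.2)) (by fun_prop)
  have h1 := hL (-1 / 2)
  have h2 := hL (1 / 2)
  unfold poissonDeriv
  fun_prop

lemma BddBy.poissonSemigroup (hα : ∀ i, -1 < α i) {M : ℝ} {f : (Fin d → ℝ) → ℝ}
    (hf : BddBy α M f) {t : ℝ} (ht : 0 < t) : BddBy α M (poissonSemigroup α t f) :=
  ⟨((measurable_poissonSemigroup hα hf).comp measurable_prodMk_left).aestronglyMeasurable, by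
    filter_upwards [ae_laguerreMeasure α] with x hx using abs_poissonSemigroup_le hα hf hx ht⟩

lemma BddBy.poissonDeriv (hα : ∀ i, -1 < α i) {M : ℝ} {f : (Fin d → ℝ) → ℝ}
    (hf : BddBy α M f) {t : ℝ} (ht : 0 < t) : BddBy α (2 * M / t) (poissonDeriv α t f) :=
  ⟨((measurable_poissonDeriv hα hf).comp measurable_prodMk_left).aestronglyMeasurable, by
    filter_upwards [ae_laguerreMeasure α] with x hx using abs_poissonDeriv_le hα hf hx ht⟩

/-! ### Laguerre coefficients -/

/-- Laguerre coefficients commute with dominated superpositions. -/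
lemma coeff_integral (hα : ∀ i, -1 < α i) {ν : Measure ℝ} [SFinite ν]
    {Φ : ℝ → (Fin d → ℝ) → ℝ} {D : ℝ → ℝ}
    (hΦ : AEStronglyMeasurable (fun p : (Fin d → ℝ) × ℝ => Φ p.2 p.1) ((laguerreMeasure α).prod ν))
    (hD : Integrable D ν) (hb : ∀ᵐ x ∂laguerreMeasure α, ∀ᵐ s ∂ν, |Φ s x| ≤ D s)
    (k : Fin d → ℕ) :
    coeff α k (fun x => ∫ s, Φ s x ∂ν) = ∫ s, coeff α k (Φ s) ∂ν := by
  have := isProbabilityMeasure_laguerreMeasure hα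
  have hL := integrable_laguerre hα k
  have hm : AEStronglyMeasurable (fun p : (Fin d → ℝ) × ℝ => Φ p.2 p.1 * laguerre α k p.1)
      ((laguerreMeasure α).prod ν) := hΦ.mul hL.1.comp_fst
  have hx1 : ∀ᵐ x ∂laguerreMeasure α, AEStronglyMeasurable (fun s => Φ s x) ν := hΦ.prodMk_left
  have hint : Integrable (fun p : (Fin d → ℝ) × ℝ => Φ p.2 p.1 * laguerre α k p.1)
      ((laguerreMeasure α).prod ν) := by
    rw [integrable_prod_iff hm]
    refine ⟨?_, (hL.norm.const_mul (∫ s, D s ∂ν)).mono' hm.norm.integral_prod_right' ?_⟩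
    · filter_upwards [hb, hx1] with x hx hx1
      exact (hD.mono' hx1 hx).mul_const _
    · filter_upwards [hb] with x hx
      rw [Real.norm_of_nonneg (integral_nonneg fun _ => norm_nonneg _), ← integral_mul_const]
      refine integral_mono_of_nonneg (ae_of_all _ fun _ => norm_nonneg _) (hD.mul_const _) ?_
      filter_upwards [hx] with s hs
      rw [norm_mul]
      exact mul_le_mul_of_nonneg_right hs (norm_nonneg _)
  simp only [coeff, ← integral_mul_const]
  exact integral_integral_swap hint

lemma BddBy.integral {ν : Measure ℝ} [SFinite ν]
    {Φ : ℝ → (Fin d → ℝ) → ℝ} {D : ℝ → ℝ}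
    (hΦ : AEStronglyMeasurable (fun p : (Fin d → ℝ) × ℝ => Φ p.2 p.1) ((laguerreMeasure α).prod ν))
    (hD : Integrable D ν) (hb : ∀ᵐ x ∂laguerreMeasure α, ∀ᵐ s ∂ν, |Φ s x| ≤ D s) :
    BddBy α (∫ s, D s ∂ν) (fun x => ∫ s, Φ s x ∂ν) :=
  ⟨hΦ.integral_prod_right', by
    filter_upwards [hb] with x hx
    exact norm_integral_le_of_norm_le (f := fun s => Φ s x) hD hx⟩

lemma coeff_heatSemigroup (hα : ∀ i, -1 < α i) {M : ℝ} {f : (Fin d → ℝ) → ℝ}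
    (hf : BddBy α M f) {t : ℝ} (ht : 0 < t) (k : Fin d → ℕ) :
    coeff α k (heatSemigroup α t f) = Real.exp (-(t * (∑ i, k i : ℕ))) * coeff α k f := by
  have := isProbabilityMeasure_laguerreMeasure hα
  have hL := integrable_laguerre hα k
  have hK : Measurable fun p : (Fin d → ℝ) × (Fin d → ℝ) => heatKernel α t p.1 p.2 :=
    (measurable_heatKernel α).comp (f := fun p : (Fin d → ℝ) × (Fin d → ℝ) => ((t, p.1), p.2))
      (by fun_prop)
  have hm : AEStronglyMeasurable (fun p : (Fin d → ℝ) × (Fin d → ℝ) =>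
      heatKernel α t p.1 p.2 * f p.2 * laguerre α k p.1)
      ((laguerreMeasure α).prod (laguerreMeasure α)) :=
    (hK.aestronglyMeasurable.mul hf.1.comp_snd).mul hL.1.comp_fst
  have hint : Integrable (fun p : (Fin d → ℝ) × (Fin d → ℝ) =>
      heatKernel α t p.1 p.2 * f p.2 * laguerre α k p.1)
      ((laguerreMeasure α).prod (laguerreMeasure α)) := by
    rw [integrable_prod_iff hm]
    refine ⟨?_, (hL.norm.const_mul M).mono' hm.norm.integral_prod_right' ?_⟩
    · filter_upwards [ae_laguerreMeasure α] with x hx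
      exact ((integrable_heatKernel hα ht hx).mul_bdd hf.1 hf.2).mul_const _
    · filter_upwards [ae_laguerreMeasure α] with x hx
      have h1 : ∫ y, heatKernel α t x y * (M * ‖laguerre α k x‖) ∂laguerreMeasure α =
          M * ‖laguerre α k x‖ := by
        rw [integral_mul_const, integral_heatKernel hα ht hx, one_mul]
      rw [Real.norm_of_nonneg (integral_nonneg fun _ => norm_nonneg _), ← h1]
      refine integral_mono_of_nonneg (ae_of_all _ fun _ => norm_nonneg _)
        ((integrable_heatKernel hα ht hx).mul_const _) ?_
      filter_upwards [hf.2, ae_laguerreMeasure α] with y hy hpos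
      have h0 := heatKernel_nonneg hα ht hx hpos
      simp only [norm_mul]
      rw [Real.norm_of_nonneg h0, mul_assoc, Real.norm_eq_abs (f y)]
      gcongr
  have hsw := integral_integral_swap
    (f := fun x y => heatKernel α t x y * f y * laguerre α k x) hint
  simp only [coeff, heatSemigroup, ← integral_mul_const]
  rw [hsw, ← integral_const_mul]
  refine integral_congr_ae ?_
  filter_upwards [ae_laguerreMeasure α] with y hy
  have h := integral_heatKernel_mul_laguerre hα ht k hy
  rw [mul_left_comm, ← h, ← integral_const_mul]
  refine integral_congr_ae (ae_of_all _ fun x => ?_)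
  simp only [heatKernel_symm α t x y]
  ring

/-- The Poisson semigroup multiplies the Laguerre coefficient of index `k` by `e^(-t√|k|)`. -/
lemma coeff_poissonSemigroup (hα : ∀ i, -1 < α i) {M : ℝ} {f : (Fin d → ℝ) → ℝ}
    (hf : BddBy α M f) {t : ℝ} (ht : 0 < t) (k : Fin d → ℕ) :
    coeff α k (poissonSemigroup α t f) =
      Real.exp (-(t * Real.sqrt (∑ i, k i : ℕ))) * coeff α k f := by
  set K : ℝ := ((∑ i, k i : ℕ) : ℝ) with hK
  have hK0 : 0 ≤ K := Nat.cast_nonneg _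
  have hI : IntegrableOn (fun u : ℝ => Real.exp (-u) / Real.sqrt u * M) (Ioi 0) := by
    have := integrableOn_rpow_mul_exp (p := -1 / 2) (τ := 1) (by norm_num) one_pos
    refine Integrable.mul_const ((integrableOn_congr_fun (fun u hu => ?_) measurableSet_Ioi).1 this) M
    have hu0 : (0 : ℝ) < u := hu
    rw [show (-1 / 2 : ℝ) = -(1 / 2) by norm_num, Real.rpow_neg hu0.le, ← Real.sqrt_eq_rpow, one_mul,
      div_eq_mul_inv, mul_comm]
  have hmeas : Measurable fun p : (Fin d → ℝ) × ℝ => Real.exp (-p.2) / Real.sqrt p.2 *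
      heatSemigroup α (t ^ 2 / (4 * p.2)) f p.1 :=
    Measurable.mul (by fun_prop) ((measurable_heatSemigroup hα hf.1).comp
      (f := fun p : (Fin d → ℝ) × ℝ => (t ^ 2 / (4 * p.2), p.1)) (by fun_prop))
  have h := coeff_integral hα (ν := volume.restrict (Ioi (0 : ℝ)))
    (Φ := fun u x => Real.exp (-u) / Real.sqrt u * heatSemigroup α (t ^ 2 / (4 * u)) f x)
    hmeas.aestronglyMeasurable hI ?_ k
  · have h2 : coeff α k (poissonSemigroup α t f) = 1 / Real.sqrt Real.pi * _ :=
      coeff_const_mul _ _ _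
    have hz : 0 ≤ t * Real.sqrt K := by positivity
    have h3 := integral_subordination hz
    have hpi := Real.sqrt_pos.2 Real.pi_pos
    rw [h2, h, setIntegral_congr_fun (g := fun u => Real.exp (-u) / Real.sqrt u *
      Real.exp (-((t * Real.sqrt K) ^ 2 / (4 * u))) * coeff α k f) measurableSet_Ioi,
      integral_mul_const, h3]
    · field_simp
    · intro u hu
      have hu0 : (0 : ℝ) < u := hu
      simp only
      rw [coeff_const_mul, coeff_heatSemigroup hα hf (by positivity), mul_pow, Real.sq_sqrt hK0, ← hK,
        ← mul_assoc]
      congr 4; ring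
  · filter_upwards [ae_laguerreMeasure α] with x hx
    filter_upwards [ae_restrict_mem measurableSet_Ioi] with u hu
    have hu0 : (0 : ℝ) < u := hu
    rw [abs_mul, abs_of_nonneg (by positivity : 0 ≤ Real.exp (-u) / Real.sqrt u)]
    gcongr
    exact abs_heatSemigroup_le hα hf (by positivity) hx

lemma BddBy.mono {M N : ℝ} {f : (Fin d → ℝ) → ℝ} (hf : BddBy α M f) (h : M ≤ N) : BddBy α N f :=
  ⟨hf.1, hf.2.mono fun _ hx => hx.trans h⟩

lemma BddBy.const_mul {M : ℝ} {f : (Fin d → ℝ) → ℝ} (hf : BddBy α M f) (c : ℝ) :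
    BddBy α (|c| * M) fun x => c * f x :=
  ⟨hf.1.const_mul c, hf.2.mono fun x hx => by
    rw [abs_mul]; exact mul_le_mul_of_nonneg_left hx (abs_nonneg c)⟩

lemma BddBy.sub {M N : ℝ} {f g : (Fin d → ℝ) → ℝ} (hf : BddBy α M f) (hg : BddBy α N g) :
    BddBy α (M + N) fun x => f x - g x :=
  ⟨hf.1.sub hg.1, by
    filter_upwards [hf.2, hg.2] with x h1 h2 using (abs_sub _ _).trans (add_le_add h1 h2)⟩

lemma coeff_sub (hα : ∀ i, -1 < α i) {M N : ℝ} {f g : (Fin d → ℝ) → ℝ} (hf : BddBy α M f)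
    (hg : BddBy α N g) (k : Fin d → ℕ) :
    coeff α k (fun x => f x - g x) = coeff α k f - coeff α k g := by
  have hL := integrable_laguerre hα k
  simp only [coeff, sub_mul]
  exact integral_sub (hf.integrable_mul hL) (hg.integrable_mul hL)

/-- Bounded functions are determined by their Laguerre coefficients. -/
lemma ae_eq_of_coeff_eq (hα : ∀ i, -1 < α i) {M N : ℝ} {f g : (Fin d → ℝ) → ℝ}
    (hf : BddBy α M f) (hg : BddBy α N g) (h : ∀ k, coeff α k f = coeff α k g) :
    f =ᵐ[laguerreMeasure α] g := by
  have h0 := ae_eq_zero_of_coeff_eq_zero hα (hf.sub hg) fun k => by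
    rw [coeff_sub hα hf hg, h k, sub_self]
  filter_upwards [h0] with x hx
  exact sub_eq_zero.1 hx

/-- The square root `√|k|` of the eigenvalue of index `k`. -/
def freq (k : Fin d → ℕ) : ℝ := Real.sqrt ((∑ i, k i : ℕ) : ℝ)

lemma freq_nonneg (k : Fin d → ℕ) : 0 ≤ freq k := Real.sqrt_nonneg _

lemma coeff_poissonDeriv (hα : ∀ i, -1 < α i) {M : ℝ} {f : (Fin d → ℝ) → ℝ}
    (hf : BddBy α M f) {t : ℝ} (ht : 0 < t) (k : Fin d → ℕ) :
    coeff α k (poissonDeriv α t f) = -freq k * Real.exp (-(t * freq k)) * coeff α k f := by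
  have hL := integrable_laguerre hα k
  have hM := hf.nonneg hα
  have h := (hasDerivAt_integral_of_dominated_loc_of_deriv_le (μ := laguerreMeasure α)
    (F := fun s x => poissonSemigroup α s f x * laguerre α k x)
    (F' := fun s x => poissonDeriv α s f x * laguerre α k x) (x₀ := t) (s := Ioi (t / 2))
    (bound := fun x => 2 * M / (t / 2) * ‖laguerre α k x‖)
    (Ioi_mem_nhds (by linarith)) ?_ ((hf.poissonSemigroup hα ht).integrable_mul hL)
    ((hf.poissonDeriv hα ht).1.mul hL.1) ?_ (hL.norm.const_mul _) ?_).2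
  · have h2 : HasDerivAt (fun s => Real.exp (-(s * freq k)) * coeff α k f)
        (Real.exp (-(t * freq k)) * (-(1 * freq k)) * coeff α k f) t :=
      (((hasDerivAt_id t).mul_const (freq k)).neg.exp).mul_const _
    have h3 : HasDerivAt (fun s => Real.exp (-(s * freq k)) * coeff α k f)
        (coeff α k (poissonDeriv α t f)) t := by
      refine h.congr_of_eventuallyEq ?_
      filter_upwards [Ioi_mem_nhds ht] with s hs
      exact (coeff_poissonSemigroup hα hf hs k).symm
    rw [h3.unique h2]; ring
  · filter_upwards [Ioi_mem_nhds ht] with s hs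
    exact (hf.poissonSemigroup hα hs).1.mul hL.1
  · filter_upwards [ae_laguerreMeasure α] with x hx s hs
    have hs' : t / 2 < s := hs
    have hs0 : 0 < s := by linarith
    rw [norm_mul]
    gcongr
    refine (abs_poissonDeriv_le hα hf hx hs0).trans ?_
    gcongr
  · filter_upwards [ae_laguerreMeasure α] with x hx s hs
    have hs' : t / 2 < s := hs
    exact (hasDerivAt_poissonSemigroup hα hf hx (by linarith)).mul_const _

/-- The semigroup law, differentiated in one of the times. -/
lemma poissonDeriv_add (hα : ∀ i, -1 < α i) {M : ℝ} {f : (Fin d → ℝ) → ℝ}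
    (hf : BddBy α M f) {s t : ℝ} (hs : 0 < s) (ht : 0 < t) :
    poissonDeriv α (s + t) f =ᵐ[laguerreMeasure α]
      poissonSemigroup α s (poissonDeriv α t f) := by
  have hV := hf.poissonDeriv hα ht
  refine ae_eq_of_coeff_eq hα (hf.poissonDeriv hα (by positivity)) (hV.poissonSemigroup hα hs)
    fun k => ?_
  rw [coeff_poissonDeriv hα hf (by positivity), coeff_poissonSemigroup hα hV hs,
    coeff_poissonDeriv hα hf ht, show -((s + t) * freq k) = -(s * freq k) + -(t * freq k) by ring,
    Real.exp_add, freq]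
  ring

/-- Estimates for almost every point at each time hold at almost every point for all times, by
continuity in time. -/
lemma ae_forall_pos_le {X : Type*} [MeasurableSpace X] {μ : Measure X} {F : ℝ → X → ℝ}
    {B : ℝ → ℝ} (hF : ∀ᵐ x ∂μ, ∀ t, 0 < t → ContinuousAt (fun s => F s x) t)
    (hB : ∀ t, 0 < t → ContinuousAt B t) (h : ∀ t, 0 < t → ∀ᵐ x ∂μ, F t x ≤ B t) :
    ∀ᵐ x ∂μ, ∀ t, 0 < t → F t x ≤ B t := by
  have hq : ∀ᵐ x ∂μ, ∀ q : ℚ, 0 < (q : ℝ) → F q x ≤ B q :=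
    ae_all_iff.2 fun q => by
      by_cases hq : 0 < (q : ℝ)
      · filter_upwards [h q hq] with x hx _ using hx
      · exact ae_of_all _ fun x h => absurd h hq
  filter_upwards [hF, hq] with x hx hqx t ht
  have hcl : t ∈ closure (Ioi (0 : ℝ) ∩ range ((↑) : ℚ → ℝ)) :=
    Rat.denseRange_cast.open_subset_closure_inter isOpen_Ioi ht
  refine ContinuousWithinAt.closure_le hcl (hx t ht).continuousWithinAt
    (hB t ht).continuousWithinAt ?_
  rintro _ ⟨hy, q, rfl⟩
  exact hqx q hy

/-! ### Lipschitz constants -/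

/-- For orders in `(0,1)` the derivative in the definition is the first one, and the uniform bound is
one on `poissonDeriv` almost everywhere. -/
lemma isLipConst_iff (hα : ∀ i, -1 < α i) {β : ℝ} (hβ1 : β < 1) {M : ℝ}
    {f : (Fin d → ℝ) → ℝ} (hf : BddBy α M f) {A : ℝ} :
    IsLipConst α β f A ↔ 0 ≤ A ∧ ∀ t : ℝ, 0 < t →
      ∀ᵐ x ∂laguerreMeasure α, |poissonDeriv α t f x| ≤ A * t ^ (β - 1) := by
  have hfl : ⌊β⌋₊ = 0 := Nat.floor_eq_zero.2 hβ1
  unfold IsLipConst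
  rw [hfl]
  refine and_congr_right fun hA => forall_congr' fun t => forall_congr' fun ht => ?_
  have he : -((0 + 1 : ℕ) : ℝ) + β = β - 1 := by push_cast; ring
  rw [he, zero_add, eLpNorm_exponent_top]
  have hae : ∀ᵐ x ∂laguerreMeasure α,
      iteratedDeriv 1 (fun s => poissonSemigroup α s f x) t = poissonDeriv α t f x := by
    filter_upwards [ae_laguerreMeasure α] with x hx
    rw [iteratedDeriv_one]
    exact (hasDerivAt_poissonSemigroup hα hf hx ht).deriv
  have h0 : 0 ≤ A * t ^ (β - 1) := by positivity
  rw [eLpNormEssSup_congr_ae hae]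
  constructor
  · intro h
    filter_upwards [enorm_ae_le_eLpNormEssSup (poissonDeriv α t f) (laguerreMeasure α)] with x hx
    have := hx.trans h
    rwa [Real.enorm_eq_ofReal_abs, ENNReal.ofReal_le_ofReal_iff h0] at this
  · intro h
    refine eLpNormEssSup_le_of_ae_enorm_bound (h.mono fun x hx => ?_)
    rw [Real.enorm_eq_ofReal_abs]
    exact ENNReal.ofReal_le_ofReal hx

/-- The smallest Lipschitz constant exists. -/
lemma isLipConst_sInf {β : ℝ} {f : (Fin d → ℝ) → ℝ} (h : ∃ A, IsLipConst α β f A) :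
    IsLipConst α β f (sInf {A | IsLipConst α β f A}) := by
  have hbdd : BddBelow {A | IsLipConst α β f A} := ⟨0, fun A hA => hA.1⟩
  refine ⟨Real.sInf_nonneg fun A hA => hA.1, fun t ht => ?_⟩
  obtain ⟨u, -, hu, hmem⟩ := exists_seq_tendsto_sInf h hbdd
  refine ge_of_tendsto' (ENNReal.tendsto_ofReal (hu.mul_const _)) fun n => (hmem n).2 t ht

section Lip

variable {β M A : ℝ} {f : (Fin d → ℝ) → ℝ}

lemma ae_forall_abs_poissonDeriv_le (hα : ∀ i, -1 < α i) (hf : BddBy α M f)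
    (hA : ∀ t : ℝ, 0 < t → ∀ᵐ x ∂laguerreMeasure α, |poissonDeriv α t f x| ≤ A * t ^ (β - 1)) :
    ∀ᵐ x ∂laguerreMeasure α, ∀ t, 0 < t → |poissonDeriv α t f x| ≤ A * t ^ (β - 1) := by
  refine ae_forall_pos_le ?_ (fun t ht => ?_) hA
  · filter_upwards [ae_laguerreMeasure α] with x hx t ht
    exact (continuousAt_poissonDeriv hα hf hx ht).abs
  · exact continuousAt_const.mul (Real.continuousAt_rpow_const _ _ (Or.inl ht.ne'))

lemma abs_poissonSemigroup_sub_le (hα : ∀ i, -1 < α i) (hβ0 : 0 < β) (hf : BddBy α M f)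
    {x : Fin d → ℝ} (hx : ∀ i, 0 < x i)
    (hA : ∀ t, 0 < t → |poissonDeriv α t f x| ≤ A * t ^ (β - 1)) {s t : ℝ} (hs : 0 < s)
    (hst : s ≤ t) :
    |poissonSemigroup α t f x - poissonSemigroup α s f x| ≤ A / β * t ^ β - A / β * s ^ β := by
  have hP : ∀ r ∈ Ioi (0 : ℝ), HasDerivAt (fun r => A / β * r ^ β) (A * r ^ (β - 1)) r :=
    fun r hr => ((Real.hasDerivAt_rpow_const (Or.inl (ne_of_gt hr))).const_mul (A / β)).congr_deriv
      (by field_simp)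
  have hu : ∀ r ∈ Ioi (0 : ℝ), HasDerivAt (fun r => poissonSemigroup α r f x)
      (poissonDeriv α r f x) r := fun r hr => hasDerivAt_poissonSemigroup hα hf hx hr
  have h1 : MonotoneOn (fun r => A / β * r ^ β - poissonSemigroup α r f x) (Ioi 0) := by
    refine monotoneOn_of_deriv_nonneg (convex_Ioi 0)
      (fun r hr => ((hP r hr).sub (hu r hr)).continuousAt.continuousWithinAt)
      (fun r hr => ((hP r (interior_subset hr)).sub
        (hu r (interior_subset hr))).differentiableAt.differentiableWithinAt) fun r hr => ?_
    have hr' := interior_subset hr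
    have := ((hP r hr').sub (hu r hr')).deriv
    rw [show deriv (fun r => A / β * r ^ β - poissonSemigroup α r f x) r = _ from this]
    linarith [le_abs_self (poissonDeriv α r f x), hA r hr']
  have h2 : MonotoneOn (fun r => A / β * r ^ β + poissonSemigroup α r f x) (Ioi 0) := by
    refine monotoneOn_of_deriv_nonneg (convex_Ioi 0)
      (fun r hr => ((hP r hr).add (hu r hr)).continuousAt.continuousWithinAt)
      (fun r hr => ((hP r (interior_subset hr)).add
        (hu r (interior_subset hr))).differentiableAt.differentiableWithinAt) fun r hr => ?_
    have hr' := interior_subset hr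
    have := ((hP r hr').add (hu r hr')).deriv
    rw [show deriv (fun r => A / β * r ^ β + poissonSemigroup α r f x) r = _ from this]
    linarith [neg_abs_le (poissonDeriv α r f x), hA r hr']
  have e1 := h1 (show s ∈ Ioi 0 from hs) (show t ∈ Ioi 0 from hs.trans_le hst) hst
  have e2 := h2 (show s ∈ Ioi 0 from hs) (show t ∈ Ioi 0 from hs.trans_le hst) hst
  simp only at e1 e2
  rw [abs_le]
  constructor <;> linarith

/-- For a Lipschitz function `f`, `P_t f` converges to `f` uniformly at the rate `t ^ β`. The limit
exists by the Cauchy criterion, and is `f` because it has the same Laguerre coefficients. -/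
lemma ae_forall_abs_poissonSemigroup_sub_le (hα : ∀ i, -1 < α i) (hβ0 : 0 < β) (hA0 : 0 ≤ A)
    (hf : BddBy α M f)
    (hA : ∀ t : ℝ, 0 < t → ∀ᵐ x ∂laguerreMeasure α, |poissonDeriv α t f x| ≤ A * t ^ (β - 1)) :
    ∀ᵐ x ∂laguerreMeasure α, ∀ t, 0 < t → |poissonSemigroup α t f x - f x| ≤ A / β * t ^ β := by
  set r : ℕ → ℝ := fun n => 1 / ((n : ℝ) + 1) with hr
  have hr0 : ∀ n, 0 < r n := fun n => by positivity
  have hrlim : Filter.Tendsto r Filter.atTop (nhds 0) := tendsto_one_div_add_atTop_nhds_zero_nat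
  have hranti : Antitone r := fun m n hmn => by simp only [hr]; gcongr
  have hrpow : Filter.Tendsto (fun n => A / β * r n ^ β) Filter.atTop (nhds 0) := by
    have := (hrlim.rpow_const (p := β) (Or.inr hβ0.le)).const_mul (A / β)
    rwa [Real.zero_rpow hβ0.ne', mul_zero] at this
  have hest : ∀ᵐ x ∂laguerreMeasure α, ∀ s t, 0 < s → s ≤ t →
      |poissonSemigroup α t f x - poissonSemigroup α s f x| ≤ A / β * t ^ β := by
    filter_upwards [ae_laguerreMeasure α, ae_forall_abs_poissonDeriv_le hα hf hA] with
      x hx hV s t hs hst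
    refine (abs_poissonSemigroup_sub_le hα hβ0 hf hx hV hs hst).trans ?_
    have : 0 ≤ A / β * s ^ β := by positivity
    linarith
  set u₀ : (Fin d → ℝ) → ℝ := fun x =>
    Filter.limUnder Filter.atTop fun n => poissonSemigroup α (r n) f x with hu₀
  have hlim : ∀ᵐ x ∂laguerreMeasure α,
      Filter.Tendsto (fun n => poissonSemigroup α (r n) f x) Filter.atTop (nhds (u₀ x)) := by
    filter_upwards [hest] with x hx
    refine CauchySeq.tendsto_limUnder (cauchySeq_of_le_tendsto_0' _ (fun n m hnm => ?_) hrpow)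
    rw [Real.dist_eq]
    exact hx _ _ (hr0 m) (hranti hnm)
  have hP : ∀ n, BddBy α M (poissonSemigroup α (r n) f) := fun n => hf.poissonSemigroup hα (hr0 n)
  have hu₀b : BddBy α M u₀ := by
    refine ⟨aestronglyMeasurable_of_tendsto_ae _ (fun n => (hP n).1) hlim, ?_⟩
    filter_upwards [hlim, ae_all_iff.2 fun n => (hP n).2] with x hx hb
    exact le_of_tendsto' hx.abs hb
  have hu₀f : u₀ =ᵐ[laguerreMeasure α] f := by
    refine ae_eq_of_coeff_eq hα hu₀b hf fun k => ?_
    have hL := integrable_laguerre hα k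
    have h1 : Filter.Tendsto (fun n => coeff α k (poissonSemigroup α (r n) f)) Filter.atTop
        (nhds (coeff α k u₀)) := by
      refine tendsto_integral_of_dominated_convergence (fun x => M * ‖laguerre α k x‖)
        (fun n => (hP n).1.mul hL.1) (hL.norm.const_mul M) (fun n => ?_) ?_
      · filter_upwards [(hP n).2] with x hx
        rw [norm_mul]
        exact mul_le_mul_of_nonneg_right hx (norm_nonneg _)
      · filter_upwards [hlim] with x hx using hx.mul_const _
    have h2 : Filter.Tendsto (fun n => coeff α k (poissonSemigroup α (r n) f)) Filter.atTop
        (nhds (coeff α k f)) := by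
      simp_rw [fun n => coeff_poissonSemigroup hα hf (hr0 n) k]
      have h3 : Filter.Tendsto (fun n => Real.exp (-(r n * Real.sqrt (∑ i, k i : ℕ))) *
          coeff α k f) Filter.atTop (nhds (Real.exp (-(0 * Real.sqrt (∑ i, k i : ℕ))) *
          coeff α k f)) :=
        (((hrlim.mul_const _).neg).rexp).mul_const _
      simpa using h3
    exact tendsto_nhds_unique h1 h2
  filter_upwards [hest, hlim, hu₀f] with x hx hxlim hxf t ht
  rw [← hxf]
  refine le_of_tendsto (tendsto_const_nhds.sub hxlim).abs ?_
  filter_upwards [hrlim.eventually (Iic_mem_nhds ht)] with n hn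
  exact hx _ _ (hr0 n) hn

/-- The time derivative is Lipschitz in time: write `∂P_{t+s} f = P_{s+t/2} (∂P_{t/2} f)` and use
that `∂P_{t/2} f` is bounded. -/
lemma ae_forall_abs_poissonDeriv_sub_le (hα : ∀ i, -1 < α i) (hβ0 : 0 < β) (hA0 : 0 ≤ A)
    (hf : BddBy α M f)
    (hA : ∀ t : ℝ, 0 < t → ∀ᵐ x ∂laguerreMeasure α, |poissonDeriv α t f x| ≤ A * t ^ (β - 1))
    {t : ℝ} (ht : 0 < t) :
    ∀ᵐ x ∂laguerreMeasure α, ∀ s, 0 < s →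
      |poissonDeriv α (t + s) f x - poissonDeriv α t f x| ≤ 8 * A * t ^ (β - 2) * s := by
  have ht2 : 0 < t / 2 := by positivity
  have hw : BddBy α (A * (t / 2) ^ (β - 1)) (poissonDeriv α (t / 2) f) :=
    ⟨(hf.poissonDeriv hα ht2).1, hA _ ht2⟩
  -- `2 ‖∂P_{t/2} f‖_∞ / (t/2)` is the Lipschitz constant in time of `P_r (∂P_{t/2} f)`, `r ≥ t/2`.
  have hconst : 2 * (A * (t / 2) ^ (β - 1)) / (t / 2) ≤ 8 * A * t ^ (β - 2) := by
    have e1 : (t / 2) ^ (β - 1) ≤ 2 * t ^ (β - 1) := by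
      rw [Real.div_rpow ht.le zero_le_two, div_le_iff₀ (by positivity)]
      have : (1 : ℝ) ≤ 2 * 2 ^ (β - 1) := by
        nth_rewrite 1 [← Real.rpow_zero 2]
        rw [mul_comm, ← Real.rpow_add_one two_ne_zero]
        exact Real.rpow_le_rpow_of_exponent_le one_le_two (by linarith)
      nlinarith [Real.rpow_pos_of_pos ht (β - 1)]
    have e2 : t ^ (β - 2) = t ^ (β - 1) / t := by
      rw [← Real.rpow_sub_one ht.ne']; ring_nf
    rw [e2]
    calc _ ≤ 2 * (A * (2 * t ^ (β - 1))) / (t / 2) := by gcongr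
      _ = _ := by field_simp; ring
  refine ae_forall_pos_le (F := fun s x => |poissonDeriv α (t + s) f x - poissonDeriv α t f x|)
    (B := fun s => 8 * A * t ^ (β - 2) * s) ?_ (fun s _ => by fun_prop) fun s hs => ?_
  · filter_upwards [ae_laguerreMeasure α] with x hx s hs
    have h := continuousAt_poissonDeriv hα hf hx (show 0 < t + s by positivity)
    have h2 : ContinuousAt (fun s => poissonDeriv α (t + s) f x) s :=
      ContinuousAt.comp (f := fun s => t + s) h (by fun_prop)
    exact (h2.sub continuousAt_const).abs
  · have h1 := poissonDeriv_add hα hf (show 0 < t / 2 + s by positivity) ht2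
    have h2 := poissonDeriv_add hα hf ht2 ht2
    rw [show t / 2 + s + t / 2 = t + s by ring] at h1
    rw [add_halves] at h2
    filter_upwards [ae_laguerreMeasure α, h1, h2] with x hx e1 e2
    rw [e1, e2]
    have h3 := Convex.norm_image_sub_le_of_norm_hasDerivWithin_le (s := Ici (t / 2))
      (f := fun r => poissonSemigroup α r (poissonDeriv α (t / 2) f) x)
      (f' := fun r => poissonDeriv α r (poissonDeriv α (t / 2) f) x)
      (C := 8 * A * t ^ (β - 2)) (x := t / 2) (y := t / 2 + s)
      (fun r hr => (hasDerivAt_poissonSemigroup hα hw hx (ht2.trans_le hr)).hasDerivWithinAt)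
      (fun r hr => ?_) (convex_Ici _) self_mem_Ici (by simp [hs.le])
    · simpa [abs_of_pos hs] using h3
    · have hr' : t / 2 ≤ r := hr
      refine ((abs_poissonDeriv_le hα hw hx (ht2.trans_le hr)).trans ?_).trans hconst
      have := hw.nonneg hα
      gcongr

end Lip

/-! ### Fractional integrals in time -/

section Tail

variable {lam θ τ a b : ℝ}

/-- The majorant `a s ^ θ` for `s ≤ τ` and `b` for `s > τ`. -/
def splitBound (θ τ a b s : ℝ) : ℝ := if s ≤ τ then a * s ^ θ else b

lemma splitBound_weight_eqOn_Ioc : EqOn (fun s : ℝ => s ^ (-lam - 1) * splitBound θ τ a b s)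
    (fun s => a * s ^ (θ - lam - 1)) (Ioc 0 τ) := fun s hs => by
  have : s ^ (θ - lam - 1) = s ^ (-lam - 1) * s ^ θ := by
    rw [← Real.rpow_add hs.1]; ring_nf
  simp only [splitBound, if_pos hs.2, this]
  ring

lemma splitBound_weight_eqOn_Ioi : EqOn (fun s : ℝ => s ^ (-lam - 1) * splitBound θ τ a b s)
    (fun s => b * s ^ (-lam - 1)) (Ioi τ) := fun s hs => by
  have hs' : ¬ s ≤ τ := not_le.2 hs
  simp only [splitBound, if_neg hs']
  ring

lemma integrableOn_splitBound_Ioc (hθ : lam < θ) (hτ : 0 < τ) :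
    IntegrableOn (fun s : ℝ => s ^ (-lam - 1) * splitBound θ τ a b s) (Ioc 0 τ) := by
  rw [integrableOn_congr_fun splitBound_weight_eqOn_Ioc measurableSet_Ioc]
  refine Integrable.const_mul ?_ _
  exact (intervalIntegrable_iff_integrableOn_Ioc_of_le hτ.le).1
    (intervalIntegral.intervalIntegrable_rpow' (by linarith))

lemma integrableOn_splitBound_Ioi (hlam : 0 < lam) (hτ : 0 < τ) :
    IntegrableOn (fun s : ℝ => s ^ (-lam - 1) * splitBound θ τ a b s) (Ioi τ) := by
  rw [integrableOn_congr_fun splitBound_weight_eqOn_Ioi measurableSet_Ioi]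
  exact (integrableOn_Ioi_rpow_of_lt (by linarith) hτ).const_mul _

lemma integrableOn_splitBound (hlam : 0 < lam) (hθ : lam < θ) (hτ : 0 < τ) :
    IntegrableOn (fun s : ℝ => s ^ (-lam - 1) * splitBound θ τ a b s) (Ioi 0) := by
  rw [← Ioc_union_Ioi_eq_Ioi hτ.le]
  exact (integrableOn_splitBound_Ioc hθ hτ).union (integrableOn_splitBound_Ioi hlam hτ)

lemma integral_splitBound (hlam : 0 < lam) (hθ : lam < θ) (hτ : 0 < τ) :
    ∫ s in Ioi (0 : ℝ), s ^ (-lam - 1) * splitBound θ τ a b s =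
      a * τ ^ (θ - lam) / (θ - lam) + b * τ ^ (-lam) / lam := by
  rw [← Ioc_union_Ioi_eq_Ioi hτ.le, setIntegral_union (Ioc_disjoint_Ioi le_rfl) measurableSet_Ioi
    (integrableOn_splitBound_Ioc hθ hτ) (integrableOn_splitBound_Ioi hlam hτ),
    setIntegral_congr_fun measurableSet_Ioc splitBound_weight_eqOn_Ioc,
    setIntegral_congr_fun measurableSet_Ioi splitBound_weight_eqOn_Ioi,
    integral_const_mul, integral_const_mul, integral_Ioi_rpow_of_lt (by linarith) hτ,
    ← intervalIntegral.integral_of_le hτ.le, integral_rpow (Or.inl (by linarith)),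
    sub_add_cancel, sub_add_cancel, Real.zero_rpow (by linarith)]
  field_simp
  ring

/-- Weighted time averages of a family of functions with a majorant of the split form: absolute
convergence, boundedness and Laguerre coefficients. -/
lemma fractional_average (hα : ∀ i, -1 < α i) (hlam : 0 < lam) (hθ : lam < θ) (hτ : 0 < τ)
    {Φ : ℝ → (Fin d → ℝ) → ℝ}
    (hΦ : AEStronglyMeasurable (fun p : (Fin d → ℝ) × ℝ => Φ p.2 p.1)
      ((laguerreMeasure α).prod (volume.restrict (Ioi (0 : ℝ)))))
    (hb : ∀ᵐ x ∂laguerreMeasure α, ∀ s, 0 < s → |Φ s x| ≤ splitBound θ τ a b s) :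
    (∀ᵐ x ∂laguerreMeasure α, IntegrableOn (fun s => s ^ (-lam - 1) * Φ s x) (Ioi 0)) ∧
    BddBy α (a * τ ^ (θ - lam) / (θ - lam) + b * τ ^ (-lam) / lam)
      (fun x => ∫ s in Ioi (0 : ℝ), s ^ (-lam - 1) * Φ s x) ∧
    ∀ k, coeff α k (fun x => ∫ s in Ioi (0 : ℝ), s ^ (-lam - 1) * Φ s x) =
      ∫ s in Ioi (0 : ℝ), s ^ (-lam - 1) * coeff α k (Φ s) := by
  have := isProbabilityMeasure_laguerreMeasure hα
  have hD := integrableOn_splitBound (a := a) (b := b) hlam hθ hτ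
  have hm : AEStronglyMeasurable (fun p : (Fin d → ℝ) × ℝ => p.2 ^ (-lam - 1) * Φ p.2 p.1)
      ((laguerreMeasure α).prod (volume.restrict (Ioi (0 : ℝ)))) :=
    (Measurable.aestronglyMeasurable (by fun_prop)).mul hΦ
  have hb' : ∀ᵐ x ∂laguerreMeasure α, ∀ᵐ s ∂volume.restrict (Ioi (0 : ℝ)),
      |s ^ (-lam - 1) * Φ s x| ≤ s ^ (-lam - 1) * splitBound θ τ a b s := by
    filter_upwards [hb] with x hx
    filter_upwards [ae_restrict_mem measurableSet_Ioi] with s hs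
    have h0 : 0 ≤ s ^ (-lam - 1) := Real.rpow_nonneg (le_of_lt hs) _
    rw [abs_mul, abs_of_nonneg h0]
    exact mul_le_mul_of_nonneg_left (hx s hs) h0
  refine ⟨?_, ?_, fun k => ?_⟩
  · have hx1 : ∀ᵐ x ∂laguerreMeasure α, AEStronglyMeasurable (fun s => s ^ (-lam - 1) * Φ s x)
      (volume.restrict (Ioi (0 : ℝ))) := hm.prodMk_left
    filter_upwards [hb', hx1] with x hx hx1
    exact hD.mono' hx1 hx
  · rw [← integral_splitBound hlam hθ hτ]
    exact BddBy.integral (Φ := fun s x => s ^ (-lam - 1) * Φ s x) hm hD hb'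
  · rw [coeff_integral hα (Φ := fun s x => s ^ (-lam - 1) * Φ s x) hm hD hb' k]
    simp only [coeff_const_mul]

end Tail

/-! ### The normalizing constant -/

lemma one_sub_exp_neg_le {s : ℝ} : 1 - Real.exp (-s) ≤ s := by
  linarith [Real.add_one_le_exp (-s)]

lemma integrableOn_cConst {lam : ℝ} (h0 : 0 < lam) (h1 : lam < 1) :
    IntegrableOn (fun u : ℝ => u ^ (-lam - 1) * (Real.exp (-u) - 1)) (Ioi 0) := by
  refine (integrableOn_splitBound (θ := 1) (τ := 1) (a := 1) (b := 1) h0 h1 one_pos).mono'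
    (Measurable.aestronglyMeasurable (by fun_prop)) ?_
  filter_upwards [ae_restrict_mem measurableSet_Ioi] with u hu
  have hu0 : (0 : ℝ) < u := hu
  have he : Real.exp (-u) ≤ 1 := by simpa using hu0.le
  rw [norm_mul, Real.norm_of_nonneg (by positivity), Real.norm_of_nonpos (by linarith)]
  refine mul_le_mul_of_nonneg_left ?_ (by positivity)
  unfold splitBound
  split_ifs
  · rw [Real.rpow_one]; linarith [one_sub_exp_neg_le (s := u)]
  · linarith [Real.exp_pos (-u)]

lemma cConst_ne_zero {lam : ℝ} (h0 : 0 < lam) (h1 : lam < 1) : cConst lam ≠ 0 := by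
  have hpos : 0 < ∫ u in Ioi (0 : ℝ), -(u ^ (-lam - 1) * (Real.exp (-u) - 1)) := by
    have hf : ∀ u : ℝ, 0 < u → 0 < -(u ^ (-lam - 1) * (Real.exp (-u) - 1)) := fun u hu => by
      have he : Real.exp (-u) < 1 := by simpa using hu
      have := Real.rpow_pos_of_pos hu (-lam - 1)
      nlinarith
    have hi : IntegrableOn (fun u : ℝ => -(u ^ (-lam - 1) * (Real.exp (-u) - 1))) (Ioi 0) :=
      (integrableOn_cConst h0 h1).neg
    rw [setIntegral_pos_iff_support_of_nonneg_ae _ hi]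
    · refine lt_of_lt_of_le ?_ (measure_mono (show Ioi (0 : ℝ) ⊆ _ from
        fun u hu => ⟨(hf u hu).ne', hu⟩))
      simp
    · filter_upwards [ae_restrict_mem measurableSet_Ioi] with u hu using (hf u hu).le
  intro h
  rw [cConst] at h
  rw [integral_neg, h] at hpos
  simp at hpos

/-- By scaling, `∫ u^(-λ-1) (e^(-uw) - 1) du = w^λ c_λ`: the origin of the factor `(1 + √|k|)^λ`. -/
lemma integral_exp_sub_one {lam w : ℝ} (hw : 0 < w) :
    ∫ u in Ioi (0 : ℝ), u ^ (-lam - 1) * (Real.exp (-(u * w)) - 1) = w ^ lam * cConst lam := by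
  have h := integral_comp_mul_left_Ioi
    (fun u : ℝ => u ^ (-lam - 1) * (Real.exp (-u) - 1)) 0 hw
  rw [mul_zero, ← cConst, smul_eq_mul] at h
  have hc : ∫ u in Ioi (0 : ℝ), (w * u) ^ (-lam - 1) * (Real.exp (-(w * u)) - 1) =
      w ^ (-lam - 1) * ∫ u in Ioi (0 : ℝ), u ^ (-lam - 1) * (Real.exp (-(u * w)) - 1) := by
    rw [← integral_const_mul]
    refine setIntegral_congr_fun measurableSet_Ioi fun u hu => ?_
    have hwu : (w * u) ^ (-lam - 1) = w ^ (-lam - 1) * u ^ (-lam - 1) :=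
      Real.mul_rpow hw.le (le_of_lt hu)
    simp only [hwu]
    rw [mul_comm u w]
    ring
  rw [hc] at h
  have hp := Real.rpow_pos_of_pos hw (-lam - 1)
  have he : w ^ lam * w ^ (-lam - 1) = w⁻¹ := by
    rw [← Real.rpow_add hw, ← Real.rpow_neg_one]; ring_nf
  refine mul_left_cancel₀ hp.ne' ?_
  rw [h, ← he]; ring

/-! ### The fractional derivative of a Lipschitz function -/

section Main

variable {lam β M A : ℝ} {f : (Fin d → ℝ) → ℝ}

/-- Absolute convergence, boundedness and Laguerre coefficients of the fractional derivative. -/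
lemma besselDeriv_basic (hα : ∀ i, -1 < α i) (hlam : 0 < lam) (hlamβ : lam < β) (hβ : β < 1)
    (hf : BddBy α M f) (hA0 : 0 ≤ A)
    (hA : ∀ t : ℝ, 0 < t → ∀ᵐ x ∂laguerreMeasure α, |poissonDeriv α t f x| ≤ A * t ^ (β - 1)) :
    (∀ᵐ x ∂laguerreMeasure α, IntegrableOn (besselDerivIntegrand α lam f x) (Ioi 0)) ∧
    BddBy α (|1 / cConst lam| * ((A / β + M) / (β - lam) + 2 * M / lam)) (besselDeriv α lam f) ∧
    ∀ k, coeff α k (besselDeriv α lam f) = (1 + freq k) ^ lam * coeff α k f := by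
  have := isProbabilityMeasure_laguerreMeasure hα
  have hβ0 : 0 < β := hlam.trans hlamβ
  have hM := hf.nonneg hα
  have hmeas : AEStronglyMeasurable (fun p : (Fin d → ℝ) × ℝ =>
      Real.exp (-p.2) * poissonSemigroup α p.2 f p.1 - f p.1)
      ((laguerreMeasure α).prod (volume.restrict (Ioi (0 : ℝ)))) := by
    refine AEStronglyMeasurable.sub (Measurable.aestronglyMeasurable ?_) hf.1.comp_fst
    exact Measurable.mul (by fun_prop)
      ((measurable_poissonSemigroup hα hf).comp
        (f := fun p : (Fin d → ℝ) × ℝ => (p.2, p.1)) (by fun_prop))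
  have hbound : ∀ᵐ x ∂laguerreMeasure α, ∀ s, 0 < s →
      |Real.exp (-s) * poissonSemigroup α s f x - f x| ≤ splitBound β 1 (A / β + M) (2 * M) s := by
    filter_upwards [ae_laguerreMeasure α, hf.2,
      ae_forall_abs_poissonSemigroup_sub_le hα hβ0 hA0 hf hA] with x hx hxM hxP s hs
    have hP := abs_poissonSemigroup_le hα hf hx hs
    have he0 := Real.exp_pos (-s)
    have he1 : Real.exp (-s) ≤ 1 := by simpa using hs.le
    unfold splitBound
    split_ifs with hs1
    · have hd : Real.exp (-s) * poissonSemigroup α s f x - f x =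
          Real.exp (-s) * (poissonSemigroup α s f x - f x) - (1 - Real.exp (-s)) * f x := by ring
      have hsβ : s ≤ s ^ β := by
        nth_rewrite 1 [← Real.rpow_one s]
        exact Real.rpow_le_rpow_of_exponent_ge hs hs1 hβ.le
      rw [hd]
      calc _ ≤ 1 * (A / β * s ^ β) + s ^ β * M := by
            refine (abs_sub _ _).trans (add_le_add ?_ ?_)
            · rw [abs_mul, abs_of_pos he0]
              exact mul_le_mul he1 (hxP s hs) (abs_nonneg _) zero_le_one
            · rw [abs_mul, abs_of_nonneg (by linarith : 0 ≤ 1 - Real.exp (-s))]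
              exact mul_le_mul (one_sub_exp_neg_le.trans hsβ) hxM (abs_nonneg _)
                (by positivity)
        _ = _ := by ring
    · calc _ ≤ 1 * M + M := by
            refine (abs_sub _ _).trans (add_le_add ?_ hxM)
            rw [abs_mul, abs_of_pos he0]
            exact mul_le_mul he1 hP (abs_nonneg _) zero_le_one
        _ = _ := by ring
  obtain ⟨h1, h2, h3⟩ := fractional_average hα hlam hlamβ one_pos hmeas hbound
  refine ⟨h1, ?_, fun k => ?_⟩
  · have := h2.const_mul (1 / cConst lam)
    simp only [Real.one_rpow, mul_one] at this
    exact this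
  · have hw : 0 < 1 + freq k := by linarith [freq_nonneg k]
    have hc := cConst_ne_zero hlam (hlamβ.trans hβ)
    change coeff α k (fun x => 1 / cConst lam * _) = _
    rw [coeff_const_mul]
    change 1 / cConst lam * coeff α k (fun x => ∫ s in Ioi (0 : ℝ), s ^ (-lam - 1) *
      (Real.exp (-s) * poissonSemigroup α s f x - f x)) = _
    rw [h3, setIntegral_congr_fun (g := fun s => s ^ (-lam - 1) *
      (Real.exp (-(s * (1 + freq k))) - 1) * coeff α k f) measurableSet_Ioi, integral_mul_const,
      integral_exp_sub_one hw]
    · field_simp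
    · intro s hs
      have hP := hf.poissonSemigroup hα hs
      simp only
      rw [coeff_sub hα (hP.const_mul _) hf, coeff_const_mul, coeff_poissonSemigroup hα hf hs,
        show -(s * (1 + freq k)) = -s + -(s * freq k) by ring, Real.exp_add, freq]
      ring

/-- For times `t ≤ 1`, `∂P_t` of the fractional derivative of `f` is the
weighted average of `e^(-s) ∂P_{t+s} f - ∂P_t f`, which is small for `s ≤ t` because `∂P_t f` is
Lipschitz in time, and is bounded by `2 A t ^ (β - 1)` for `s > t`. -/
lemma abs_poissonDeriv_besselDeriv_le_of_le_one (hα : ∀ i, -1 < α i) (hlam : 0 < lam)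
    (hlamβ : lam < β) (hβ : β < 1) (hf : BddBy α M f) (hA0 : 0 ≤ A)
    (hA : ∀ t : ℝ, 0 < t → ∀ᵐ x ∂laguerreMeasure α, |poissonDeriv α t f x| ≤ A * t ^ (β - 1))
    {t : ℝ} (ht : 0 < t) (ht1 : t ≤ 1) :
    ∀ᵐ x ∂laguerreMeasure α, |poissonDeriv α t (besselDeriv α lam f) x| ≤
      |1 / cConst lam| * (A * (9 / (1 - lam) + 2 / lam)) * t ^ (β - lam - 1) := by
  have := isProbabilityMeasure_laguerreMeasure hα
  have hβ0 : 0 < β := hlam.trans hlamβ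
  have hlam1 : lam < 1 := hlamβ.trans hβ
  obtain ⟨-, hg, hgc⟩ := besselDeriv_basic hα hlam hlamβ hβ hf hA0 hA
  have hV := hf.poissonDeriv hα ht
  have hmeas : AEStronglyMeasurable (fun p : (Fin d → ℝ) × ℝ =>
      Real.exp (-p.2) * poissonDeriv α (t + p.2) f p.1 - poissonDeriv α t f p.1)
      ((laguerreMeasure α).prod (volume.restrict (Ioi (0 : ℝ)))) := by
    refine AEStronglyMeasurable.sub (Measurable.aestronglyMeasurable ?_) hV.1.comp_fst
    exact Measurable.mul (by fun_prop) ((measurable_poissonDeriv hα hf).comp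
      (f := fun p : (Fin d → ℝ) × ℝ => (t + p.2, p.1)) (by fun_prop))
  have hbound : ∀ᵐ x ∂laguerreMeasure α, ∀ s, 0 < s →
      |Real.exp (-s) * poissonDeriv α (t + s) f x - poissonDeriv α t f x| ≤
        splitBound 1 t (9 * A * t ^ (β - 2)) (2 * A * t ^ (β - 1)) s := by
    filter_upwards [ae_forall_abs_poissonDeriv_le hα hf hA,
      ae_forall_abs_poissonDeriv_sub_le hα hβ0 hA0 hf hA ht] with x hxA hxd s hs
    have he0 := Real.exp_pos (-s)
    have he1 : Real.exp (-s) ≤ 1 := by simpa using hs.le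
    have hts : A * (t + s) ^ (β - 1) ≤ A * t ^ (β - 1) :=
      mul_le_mul_of_nonneg_left
        (Real.rpow_le_rpow_of_nonpos ht (by linarith) (by linarith)) hA0
    unfold splitBound
    split_ifs
    · have hd : Real.exp (-s) * poissonDeriv α (t + s) f x - poissonDeriv α t f x =
          Real.exp (-s) * (poissonDeriv α (t + s) f x - poissonDeriv α t f x) -
            (1 - Real.exp (-s)) * poissonDeriv α t f x := by ring
      have htt : t ^ (β - 1) ≤ t ^ (β - 2) :=
        Real.rpow_le_rpow_of_exponent_ge ht ht1 (by linarith)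
      rw [hd, Real.rpow_one]
      calc _ ≤ 1 * (8 * A * t ^ (β - 2) * s) + s * (A * t ^ (β - 2)) := by
            refine (abs_sub _ _).trans (add_le_add ?_ ?_)
            · rw [abs_mul, abs_of_pos he0]
              exact mul_le_mul he1 (hxd s hs) (abs_nonneg _) zero_le_one
            · rw [abs_mul, abs_of_nonneg (by linarith : 0 ≤ 1 - Real.exp (-s))]
              exact mul_le_mul one_sub_exp_neg_le ((hxA t ht).trans
                (mul_le_mul_of_nonneg_left htt hA0)) (abs_nonneg _) hs.le
        _ = _ := by ring
    · calc _ ≤ 1 * (A * t ^ (β - 1)) + A * t ^ (β - 1) := by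
            refine (abs_sub _ _).trans (add_le_add ?_ (hxA t ht))
            rw [abs_mul, abs_of_pos he0]
            exact mul_le_mul he1 ((hxA (t + s) (by positivity)).trans hts) (abs_nonneg _)
              zero_le_one
        _ = _ := by ring
  obtain ⟨-, h2, h3⟩ := fractional_average hα hlam hlam1 ht hmeas hbound
  have hB := h2.const_mul (1 / cConst lam)
  have heq := ae_eq_of_coeff_eq hα (hg.poissonDeriv hα ht) hB fun k => by
    have hw : 0 < 1 + freq k := by linarith [freq_nonneg k]
    have hc := cConst_ne_zero hlam hlam1
    rw [coeff_poissonDeriv hα hg ht, hgc, coeff_const_mul, h3,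
      setIntegral_congr_fun (g := fun s => s ^ (-lam - 1) *
      (Real.exp (-(s * (1 + freq k))) - 1) *
      (-freq k * Real.exp (-(t * freq k)) * coeff α k f)) measurableSet_Ioi, integral_mul_const,
      integral_exp_sub_one hw]
    · field_simp
    · intro s hs
      have hs0 : (0 : ℝ) < s := hs
      have hts : 0 < t + s := by positivity
      simp only
      rw [coeff_sub hα ((hf.poissonDeriv hα hts).const_mul _) hV, coeff_const_mul,
        coeff_poissonDeriv hα hf hts, coeff_poissonDeriv hα hf ht,
        show -(s * (1 + freq k)) = -s + -(s * freq k) by ring,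
        show -((t + s) * freq k) = -(t * freq k) + -(s * freq k) by ring, Real.exp_add,
        Real.exp_add]
      ring
  filter_upwards [heq, hB.2] with x hx hxB
  rw [hx]
  refine hxB.trans (le_of_eq ?_)
  have e1 : t ^ (β - 2) * t ^ (1 - lam) = t ^ (β - lam - 1) := by
    rw [← Real.rpow_add ht]; ring_nf
  have e2 : t ^ (β - 1) * t ^ (-lam) = t ^ (β - lam - 1) := by
    rw [← Real.rpow_add ht]; ring_nf
  rw [mul_assoc (9 * A), mul_assoc (2 * A), e1, e2]
  ring

/-- The estimate for `t ≤ 1` together with the bound `2 ‖g‖_∞ / t` for `t > 1`. -/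
lemma isLipConst_besselDeriv (hα : ∀ i, -1 < α i) (hlam : 0 < lam) (hlamβ : lam < β) (hβ : β < 1)
    (hf : BddBy α M f) (hA : IsLipConst α β f A) :
    IsLipConst α (β - lam) (besselDeriv α lam f)
      (|1 / cConst lam| * (A * (9 / (1 - lam) + 2 / lam) +
        2 * ((A / β + M) / (β - lam) + 2 * M / lam))) := by
  have hβ0 : 0 < β := hlam.trans hlamβ
  have hlam1 : 0 < 1 - lam := by linarith
  have hβl : 0 < β - lam := by linarith
  have hM := hf.nonneg hα
  obtain ⟨hA0, hA'⟩ := (isLipConst_iff hα hβ hf).1 hA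
  obtain ⟨-, hg, -⟩ := besselDeriv_basic hα hlam hlamβ hβ hf hA0 hA'
  rw [isLipConst_iff hα (by linarith) hg]
  refine ⟨by positivity, fun t ht => ?_⟩
  rcases le_or_gt t 1 with ht1 | ht1
  · filter_upwards [abs_poissonDeriv_besselDeriv_le_of_le_one hα hlam hlamβ hβ hf hA0 hA' ht ht1]
      with x hx
    refine hx.trans ?_
    have : 0 ≤ 2 * ((A / β + M) / (β - lam) + 2 * M / lam) := by positivity
    gcongr
    linarith
  · filter_upwards [(hg.poissonDeriv hα ht).2] with x hx
    refine hx.trans ?_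
    have e : 1 / t ≤ t ^ (β - lam - 1) := by
      rw [one_div, ← Real.rpow_neg_one]
      exact Real.rpow_le_rpow_of_exponent_le ht1.le (by linarith)
    have h0 : 0 ≤ A * (9 / (1 - lam) + 2 / lam) := by positivity
    calc _ = |1 / cConst lam| * (2 * ((A / β + M) / (β - lam) + 2 * M / lam)) * (1 / t) := by ring
      _ ≤ _ := by gcongr; linarith

end Main

lemma MemLp.bddBy {f : (Fin d → ℝ) → ℝ} (hf : MemLp f ⊤ (laguerreMeasure α)) :
    BddBy α (eLpNorm f ⊤ (laguerreMeasure α)).toReal f := by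
  refine ⟨hf.1, ?_⟩
  filter_upwards [enorm_ae_le_eLpNormEssSup f (laguerreMeasure α)] with x hx
  rw [← Real.norm_eq_abs, ← toReal_enorm]
  exact ENNReal.toReal_mono hf.2.ne (by rwa [eLpNorm_exponent_top])

lemma BddBy.memLp_top {M : ℝ} {f : (Fin d → ℝ) → ℝ} (hf : BddBy α M f) :
    MemLp f ⊤ (laguerreMeasure α) :=
  memLp_top_of_bound hf.1 M hf.2

lemma BddBy.toReal_eLpNorm_le (hα : ∀ i, -1 < α i) {M : ℝ} {f : (Fin d → ℝ) → ℝ}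
    (hf : BddBy α M f) : (eLpNorm f ⊤ (laguerreMeasure α)).toReal ≤ M := by
  refine ENNReal.toReal_le_of_le_ofReal (hf.nonneg hα) ?_
  rw [eLpNorm_exponent_top]
  exact eLpNormEssSup_le_of_ae_bound hf.2

end LaguerreLip
end

/-- Boundedness of the Bessel-Laguerre fractional derivative `(I + √L_α)^λ` from `Lip_β(μ_α)` to
`Lip_{β-λ}(μ_α)`, together with its integral representation. -/
theorem theorem3p3 {d : ℕ} (α : Fin d → ℝ) (hα : ∀ i, -(1 / 2 : ℝ) < α i)
    (lam β : ℝ) (hlam : 0 < lam) (hlamβ : lam < β) (hβ : β < 1) :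
    ∃ C : ℝ, ∀ f : (Fin d → ℝ) → ℝ, LaguerreLip.MemLip α β f →
      (∀ᵐ x ∂(LaguerreLip.laguerreMeasure α),
        MeasureTheory.IntegrableOn (LaguerreLip.besselDerivIntegrand α lam f x)
          (Set.Ioi (0 : ℝ))) ∧
      LaguerreLip.IsSpectralBesselDeriv α lam f (LaguerreLip.besselDeriv α lam f) ∧
      LaguerreLip.MemLip α (β - lam) (LaguerreLip.besselDeriv α lam f) ∧
      LaguerreLip.lipNorm α (β - lam) (LaguerreLip.besselDeriv α lam f) ≤
        C * LaguerreLip.lipNorm α β f := by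
  have hα1 : ∀ i, -1 < α i := fun i => by linarith [hα i]
  have hprob := LaguerreLip.isProbabilityMeasure_laguerreMeasure hα1
  refine ⟨|1 / LaguerreLip.cConst lam| * (9 / (1 - lam) + 2 / lam +
    3 * ((1 / β + 1) / (β - lam) + 2 / lam)), fun f hf => ?_⟩
  set M := (eLpNorm f ⊤ (LaguerreLip.laguerreMeasure α)).toReal with hM
  set A := sInf {A : ℝ | LaguerreLip.IsLipConst α β f A} with hA
  have hfb : LaguerreLip.BddBy α M f := LaguerreLip.MemLp.bddBy hf.1
  have hAL : LaguerreLip.IsLipConst α β f A := LaguerreLip.isLipConst_sInf hf.2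
  obtain ⟨hA0, hA'⟩ := (LaguerreLip.isLipConst_iff hα1 hβ hfb).1 hAL
  obtain ⟨h1, h2, h3⟩ := LaguerreLip.besselDeriv_basic hα1 hlam hlamβ hβ hfb hA0 hA'
  have h4 := LaguerreLip.isLipConst_besselDeriv hα1 hlam hlamβ hβ hfb hAL
  refine ⟨h1, ⟨hf.1.mono_exponent le_top, h2.memLp_top.mono_exponent le_top, h3⟩,
    ⟨h2.memLp_top, _, h4⟩, ?_⟩
  have hn := h2.toReal_eLpNorm_le hα1
  have hs := csInf_le (s := {A : ℝ | LaguerreLip.IsLipConst α (β - lam)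
    (LaguerreLip.besselDeriv α lam f) A}) ⟨0, fun A hA => hA.1⟩ h4
  have hM0 := hfb.nonneg hα1
  have hβ0 : 0 < β := hlam.trans hlamβ
  have hβl : 0 < β - lam := by linarith
  have hlam1 : 0 < 1 - lam := by linarith
  have hc := abs_nonneg (1 / LaguerreLip.cConst lam)
  have e1 : (A / β + M) / (β - lam) + 2 * M / lam ≤
      ((1 / β + 1) / (β - lam) + 2 / lam) * (M + A) := by
    have : 0 ≤ M / β / (β - lam) + A / (β - lam) + 2 * A / lam := by positivity
    have e : ((1 / β + 1) / (β - lam) + 2 / lam) * (M + A) =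
        (A / β + M) / (β - lam) + 2 * M / lam +
          (M / β / (β - lam) + A / (β - lam) + 2 * A / lam) := by ring
    linarith
  have e2 : A * (9 / (1 - lam) + 2 / lam) ≤ (9 / (1 - lam) + 2 / lam) * (M + A) := by
    rw [mul_comm]
    gcongr
    linarith
  unfold LaguerreLip.lipNorm
  calc _ ≤ |1 / LaguerreLip.cConst lam| * ((A / β + M) / (β - lam) + 2 * M / lam) +
        |1 / LaguerreLip.cConst lam| * (A * (9 / (1 - lam) + 2 / lam) +
        2 * ((A / β + M) / (β - lam) + 2 * M / lam)) := add_le_add hn hs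
    _ = |1 / LaguerreLip.cConst lam| * (A * (9 / (1 - lam) + 2 / lam) +
        3 * ((A / β + M) / (β - lam) + 2 * M / lam)) := by ring
    _ ≤ |1 / LaguerreLip.cConst lam| * ((9 / (1 - lam) + 2 / lam) * (M + A) +
        3 * (((1 / β + 1) / (β - lam) + 2 / lam) * (M + A))) := by gcongr
    _ = _ := by ring
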